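/- Let $\lambda=(\lambda_n)_{n\ge 1}$ be a frequency, i.e. a strictly increasing sequence of non-negative reals with $\lambda_n\to\infty$, and suppose that $\lambda$ satisfies Bohr's condition (BC): there is $l>0$ such that for every $\delta>0$ there is $c>0$ with $\lambda_{n+1}-\lambda_n\ge c\,e^{-(l+\delta)\lambda_n}$ for all $n$. A $\lambda$-Dirichlet group is a pair $(G,\beta)$ of a compact (Hausdorff) abelian group $G$, with normalized Haar measure, and a continuous homomorphism $\beta:(\mathbb R,+)\to G$ with dense range, such that for every $n$ there is a (necessarily unique) continuous character $h_{\lambda_n}:G\to\mathbb T$ with $h_{\lambda_n}(\beta(t))=e^{-i\lambda_n t}$ for all $t\in\mathbb R$. For $1\le p<\infty$, $H_p^\lambda(G)$ is the space of all $f\in L_p(G)$ whose Fourier transform $\widehat f(\chi)=\int_G f\,\overline{\chi}$ vanishes at every character $\chi\notin\{h_{\lambda_n}:n\in\mathbb N\}$. The Hardy space $\mathcal H_p(\lambda)$ consists of all formal series $D=\sum a_ne^{-\lambda_n s}$ for which there are a $\lambda$-Dirichlet group $(K,\kappa)$ and $f\in H_p^\lambda(K)$ with $a_n=\widehat f(h_{\lambda_n})$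 for all $n$, and $\|D\|_p:=\|f\|_{L_p(K)}$ (neither the space nor the norm depends on the choice of $(K,\kappa)$). Theorem. For every $u>0$ there is a constant $C=C(\lambda,u)>0$ such that for all $1\le p<\infty$, all $\lambda$-Dirichlet groups $(G,\beta)$ and all $D=\sum a_ne^{-\lambda_ns}\in\mathcal H_p(\lambda)$, for almost every $\omega\in G$ the following limit exists and satisfies $$\lim_{T\to\infty}\Big(\frac1{2T}\int_{-T}^{T}\sup_{N}\Big|\sum_{n=1}^{N}a_nh_{\lambda_n}(\omega)e^{-(u+it)\lambda_n}\Big|^p\,dt\Big)^{1/p}\le C\,\|D\|_p .$$ -/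

import Mathlib

open MeasureTheory Filter Topology
open scoped ENNReal

noncomputable section

/-- A frequency: a strictly increasing, non-negative real sequence tending to `+∞`
(indexed from `0`). -/
structure IsFrequency (lam : ℕ → ℝ) : Prop where
  strictMono : StrictMono lam
  nonneg : ∀ n, 0 ≤ lam n
  tendsto : Tendsto lam atTop atTop

/-- Bohr's condition `(BC)`. -/
def BohrCondition (lam : ℕ → ℝ) : Prop :=
  ∃ l : ℝ, 0 < l ∧ ∀ δ : ℝ, 0 < δ → ∃ C : ℝ, 0 < C ∧
    ∀ n : ℕ, C * Real.exp (-(l + δ) * lam n) ≤ lam (n + 1) - lam n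

/-- `(G, β)` is a `λ`-Dirichlet group (the ambient `G` being a compact Hausdorff abelian group):
`β : (ℝ, +) → G` is a continuous homomorphism with dense range, and each `e^{-iλₙ·}` is of the
form `χ ∘ β` for a continuous character `χ` of `G`. -/
structure IsLambdaDirichletGroup (lam : ℕ → ℝ) {G : Type*} [CommGroup G] [TopologicalSpace G]
    (β : Multiplicative ℝ →* G) : Prop where
  continuous : Continuous β
  denseRange : DenseRange β
  exists_char : ∀ n : ℕ, ∃ χ : G →ₜ* Circle,
    ∀ t : ℝ, χ (β (Multiplicative.ofAdd t)) = Circle.exp (-(lam n * t))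

/-- The character `h_{λₙ}` of `G`, i.e. the one with `h_{λₙ} ∘ β = e^{-iλₙ·}`. -/
def IsLambdaDirichletGroup.h {lam : ℕ → ℝ} {G : Type*} [CommGroup G] [TopologicalSpace G]
    {β : Multiplicative ℝ →* G} (hβ : IsLambdaDirichletGroup lam β) (n : ℕ) : G →ₜ* Circle :=
  (hβ.exists_char n).choose

theorem IsLambdaDirichletGroup.h_spec {lam : ℕ → ℝ} {G : Type*} [CommGroup G]
    [TopologicalSpace G] {β : Multiplicative ℝ →* G} (hβ : IsLambdaDirichletGroup lam β)
    (n : ℕ) (t : ℝ) :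
    hβ.h n (β (Multiplicative.ofAdd t)) = Circle.exp (-(lam n * t)) :=
  (hβ.exists_char n).choose_spec t

/-- `h_{λₙ}` is the only character with this property. -/
theorem IsLambdaDirichletGroup.h_unique {lam : ℕ → ℝ} {G : Type*} [CommGroup G]
    [TopologicalSpace G] {β : Multiplicative ℝ →* G} (hβ : IsLambdaDirichletGroup lam β)
    (n : ℕ) (χ : G →ₜ* Circle)
    (hχ : ∀ t : ℝ, χ (β (Multiplicative.ofAdd t)) = Circle.exp (-(lam n * t))) :
    χ = hβ.h n := by
  have h1 : (χ : G → Circle) = hβ.h n :=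
    hβ.denseRange.equalizer χ.continuous_toFun (hβ.h n).continuous_toFun
      (funext fun t => (hχ t.toAdd).trans (hβ.h_spec n t.toAdd).symm)
  exact DFunLike.coe_injective h1

/-- The (regular) Haar measure of a compact group, normalized to total mass `1`. -/
def normalizedHaar (G : Type*) [CommGroup G] [TopologicalSpace G] [IsTopologicalGroup G]
    [CompactSpace G] [MeasurableSpace G] [BorelSpace G] : Measure G :=
  Measure.haarMeasure (⊤ : TopologicalSpace.PositiveCompacts G)

/-- The Fourier coefficient of `f` at the character `χ`. -/
def groupFourierCoeff {G : Type*} [CommGroup G] [TopologicalSpace G] [IsTopologicalGroup G]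
    [CompactSpace G] [MeasurableSpace G] [BorelSpace G] (f : G → ℂ) (χ : G →ₜ* Circle) : ℂ :=
  ∫ ω, f ω * (starRingEnd ℂ) (χ ω : ℂ) ∂(normalizedHaar G)

/-- `f` belongs to `H_p^λ(G)`: it is in `L_p(G)` and its Fourier transform vanishes off
`{h_{λₙ} : n}`. -/
structure MemHardySpace {lam : ℕ → ℝ} {G : Type*} [CommGroup G] [TopologicalSpace G]
    [IsTopologicalGroup G] [CompactSpace G] [MeasurableSpace G] [BorelSpace G]
    {β : Multiplicative ℝ →* G} (hβ : IsLambdaDirichletGroup lam β) (p : ℝ≥0∞)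
    (f : G → ℂ) : Prop where
  memLp : MemLp f p (normalizedHaar G)
  support : ∀ χ : G →ₜ* Circle, (∀ n, χ ≠ hβ.h n) → groupFourierCoeff f χ = 0

/-- The Dirichlet series `∑ aₙ e^{-λₙ s}` is the Bohr transform of `f ∈ H_p^λ(G)`, that is
`aₙ = f^(h_{λₙ})` for all `n`. Thus `∑ aₙ e^{-λₙ s}` is in `𝓗_p(λ)` exactly if it is the Bohr
transform of some such `f`, and then its norm in `𝓗_p(λ)` is the norm of `f` in `L_p(G)`. -/
structure IsBohrTransform {lam : ℕ → ℝ} {G : Type*} [CommGroup G] [TopologicalSpace G]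
    [IsTopologicalGroup G] [CompactSpace G] [MeasurableSpace G] [BorelSpace G]
    {β : Multiplicative ℝ →* G} (hβ : IsLambdaDirichletGroup lam β) (p : ℝ≥0∞)
    (f : G → ℂ) (a : ℕ → ℂ) : Prop where
  mem : MemHardySpace hβ p f
  coeff : ∀ n, a n = groupFourierCoeff f (hβ.h n)

/-- `sup_N |∑_{n ≤ N} aₙ h_{λₙ}(ω) e^{-(u+it)λₙ}|`, with values in `[0, ∞]`. -/
def verticalMaximal {lam : ℕ → ℝ} {G : Type*} [CommGroup G] [TopologicalSpace G]
    {β : Multiplicative ℝ →* G} (hβ : IsLambdaDirichletGroup lam β) (a : ℕ → ℂ) (u : ℝ)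
    (ω : G) (t : ℝ) : ℝ≥0∞ :=
  ⨆ N : ℕ, ‖∑ n ∈ Finset.range (N + 1),
    a n * (hβ.h n ω : ℂ) * Complex.exp (-((u : ℂ) + Complex.I * (t : ℂ)) * (lam n : ℂ))‖ₑ

/-- `((1/2T) ∫_{-T}^{T} sup_N |∑_{n ≤ N} aₙ h_{λₙ}(ω) e^{-(u+it)λₙ}|^p dt)^{1/p}`. -/
def verticalMaximalMean {lam : ℕ → ℝ} {G : Type*} [CommGroup G] [TopologicalSpace G]
    {β : Multiplicative ℝ →* G} (hβ : IsLambdaDirichletGroup lam β) (a : ℕ → ℂ) (u p : ℝ)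
    (ω : G) (T : ℝ) : ℝ≥0∞ :=
  (ENNReal.ofReal (1 / (2 * T)) *
    ∫⁻ t in Set.Icc (-T) T, verticalMaximal hβ a u ω t ^ p) ^ (1 / p)

end

/-! Since `hβ.h n (β t) = e^{-iλₙt}`, the maximal function at height `t` on the vertical line of `ω`
is one function `Φ` on `G`, namely `sup_N |∑_{n ≤ N} aₙ h_{λₙ} e^{-uλₙ}|`, evaluated at `ω * β t`.
The quantity in question is thus an orbit mean of `Φ ^ p`. Two things are needed: a bound on `∫ Φ ^
p`, and an ergodic theorem which says that almost every orbit mean converges to that integral.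

The bound is proved on the group `K` that carries `f`. A partial sum of `f` is an average of `f`
along the flow against a kernel, the Fourier transform of a trapezoid that is `1` up to `λ_N` and
vanishes from `λ_{N+1}` on. By Bohr's condition the sloping side is not shorter than a constant
times `e^{-(l+1)λ_N}`, and interpolation reduces the cost of a short side to an arbitrarily small
power; hence the kernels times `e^{-uλ_N/2}` have a common integrable majorant `g`
(`BohrCondition.exists_kernel`). Averaging `|f|` against `g` is bounded on every `L_p` with norm at
most the integral of `g`, whence a constant free of `p` and `K`. Abel summation
(`norm_sum_mul_exp_le`) then spends the other half of `u` on putting the weights inside the sum.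
That the partial sums are these averages is checked on Fourier coefficients, so uniqueness of the
Fourier transform on a compact abelian group is proved as well
(`ae_eq_zero_of_forall_char_integral_eq_zero`).

The bound passes from `K` to `G` because the finite maxima are continuous: their integrals are the
orbit means through `1`, which depend on `λ` alone. For the ergodic theorem, `Φ ^ p` is an
increasing limit of continuous functions. These have convergent means along every orbit by unique
ergodicity, and the maximal ergodic theorem controls the remainder (`ae_tendsto_flowLMean_iSup`). -/

/-! ### Unique ergodicity of dense one-parameter flows -/

section UniqueErgodicity

variable {G : Type*} [CommGroup G] [TopologicalSpace G] [IsTopologicalGroup G]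

/-- The mean of `F` over the orbit segment `{ω * b t : |t| ≤ T}`. -/
noncomputable def flowMean (F : G → ℝ) (b : ℝ → G) (T : ℝ) (ω : G) : ℝ :=
  (2 * T)⁻¹ * ∫ t in -T..T, F (ω * b t)

/-- Moving the base point along the orbit shifts the window `[-T, T]` by `s`. The two windows differ
in two intervals of length `|s|`, and each contributes at most `C * |s|`. -/
theorem abs_flowMean_mul_sub_le {F : G → ℝ} (hF : Continuous F) {b : ℝ → G} (hb : Continuous b)
    (hadd : ∀ s t, b (s + t) = b s * b t) {C : ℝ} (hC : ∀ x, ‖F x‖ ≤ C) {T : ℝ} (hT : 0 < T)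
    (s : ℝ) (ω : G) : |flowMean F b T (b s * ω) - flowMean F b T ω| ≤ |s| * C / T := by
  have hi : ∀ a c, IntervalIntegrable (fun t => F (ω * b t)) volume a c := fun a c =>
    Continuous.intervalIntegrable (by fun_prop) _ _
  have h1 : ∫ t in -T..T, F (b s * ω * b t) = ∫ t in (-T + s)..(T + s), F (ω * b t) := by
    rw [← intervalIntegral.integral_comp_add_right]
    refine intervalIntegral.integral_congr fun t _ => ?_
    simp only [hadd]
    congr 1
    rw [mul_comm (b s) ω, mul_assoc, mul_comm (b s)]
  rw [flowMean, flowMean, h1, ← mul_sub,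
    intervalIntegral.integral_interval_sub_interval_comm (hi _ _) (hi _ _) (hi _ _), abs_mul,
    abs_of_pos (by positivity : 0 < (2 * T)⁻¹)]
  have h2 : ∀ a, ‖∫ t in a..a + s, F (ω * b t)‖ ≤ C * |s| := fun a => by
    simpa using intervalIntegral.norm_integral_le_of_norm_le_const (a := a) (b := a + s)
      (f := fun t => F (ω * b t)) (C := C) fun t _ => hC _
  have h3 : |(∫ t in (-T + s)..(-T), F (ω * b t)) - ∫ t in (T + s)..T, F (ω * b t)|
      ≤ 2 * (C * |s|) := by
    rw [intervalIntegral.integral_symm, intervalIntegral.integral_symm T]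
    calc _ ≤ ‖∫ t in (-T)..(-T + s), F (ω * b t)‖ + ‖∫ t in T..T + s, F (ω * b t)‖ := by
          rw [neg_sub_neg, ← Real.norm_eq_abs, add_comm ‖_‖]; exact norm_sub_le _ _
      _ ≤ _ := by linarith [h2 (-T), h2 T]
  calc _ ≤ (2 * T)⁻¹ * (2 * (C * |s|)) := by gcongr
    _ = _ := by field_simp

variable [CompactSpace G]

theorem eventually_forall_norm_mul_sub_lt {E : Type*} [SeminormedAddCommGroup E] {F : G → E}
    (hF : Continuous F) {ε : ℝ} (hε : 0 < ε) :
    ∀ᶠ v in 𝓝 (1 : G), ∀ x, ‖F (x * v) - F x‖ < ε := by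
  have h : ∀ y ∈ (Set.univ : Set G), ∀ᶠ z : G × G in 𝓝 ((1 : G), y),
      ‖F (z.2 * z.1) - F z.2‖ < ε := by
    intro y _
    have hc : Continuous fun z : G × G => ‖F (z.2 * z.1) - F z.2‖ := by fun_prop
    exact (hc.tendsto (1, y)).eventually_lt_const (by simpa using hε)
  filter_upwards [isCompact_univ.eventually_forall_of_forall_eventually
    (P := fun v x => ‖F (x * v) - F x‖ < ε) h] with v hv x
    using hv x (Set.mem_univ x)

/-- By compactness finitely many orbit translates of `V` cover the group. Finiteness of the set of
times is what makes the convergence below uniform in the base point. -/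
theorem exists_finset_forall_exists_inv_mul_mem {b : ℝ → G} (hd : DenseRange b) {V : Set G}
    (hV : V ∈ 𝓝 (1 : G)) : ∃ s : Finset ℝ, ∀ x, ∃ t ∈ s, (b t)⁻¹ * x ∈ V := by
  obtain ⟨s, hs⟩ := isCompact_univ.elim_finite_subcover
    (fun t : ℝ => (fun x => (b t)⁻¹ * x) ⁻¹' interior V)
    (fun t => isOpen_interior.preimage (by fun_prop)) (by
      intro x _
      have h1 : {y : G | y⁻¹ * x ∈ interior V} ∈ 𝓝 x := by
        have hc : Continuous fun y : G => y⁻¹ * x := by fun_prop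
        exact hc.continuousAt.preimage_mem_nhds (by simpa using hV)
      obtain ⟨t, ht⟩ := hd.exists_mem_open (isOpen_interior (s := {y : G | y⁻¹ * x ∈ interior V}))
        ⟨x, mem_interior_iff_mem_nhds.2 h1⟩
      exact Set.mem_iUnion.2 ⟨t, interior_subset (s := {y : G | y⁻¹ * x ∈ interior V}) ht⟩)
  refine ⟨s, fun x => ?_⟩
  have := hs (Set.mem_univ x)
  simp only [Set.mem_iUnion, Set.mem_preimage, exists_prop] at this
  obtain ⟨t, ht, hx⟩ := this
  exact ⟨t, ht, interior_subset hx⟩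

/-- Write `ω = b t * v` with `t` from a finite set and `v` near `1`. Replacing `1` by `v` changes
`F` little along the entire orbit, and the factor `b t` changes the mean by at most `|t| * C / T`.
-/
theorem eventually_forall_abs_flowMean_sub_lt {F : G → ℝ} (hF : Continuous F) {b : ℝ → G}
    (hb : Continuous b) (hadd : ∀ s t, b (s + t) = b s * b t) (hd : DenseRange b) {ε : ℝ}
    (hε : 0 < ε) :
    ∀ᶠ T in atTop, ∀ ω, |flowMean F b T ω - flowMean F b T 1| < ε := by
  obtain ⟨C, hC⟩ := isCompact_univ.exists_bound_of_continuousOn hF.continuousOn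
  replace hC : ∀ x, ‖F x‖ ≤ C := fun x => hC x (Set.mem_univ x)
  have hV := eventually_forall_norm_mul_sub_lt hF (half_pos hε)
  obtain ⟨s, hs⟩ := exists_finset_forall_exists_inv_mul_mem hd hV
  have h1 : ∀ᶠ T in atTop, ∀ t ∈ s, |t| * C / T < ε / 2 := by
    rw [eventually_all_finset]
    intro t _
    exact (tendsto_const_nhds.div_atTop tendsto_id).eventually_lt_const (half_pos hε)
  filter_upwards [h1, eventually_gt_atTop 0] with T hT hT0 ω
  obtain ⟨t, ht, hω⟩ := hs ω
  set v := (b t)⁻¹ * ω with hv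
  have hω' : ω = b t * v := by rw [hv]; group
  have h2 : |flowMean F b T v - flowMean F b T 1| ≤ ε / 2 := by
    rw [flowMean, flowMean, ← mul_sub, abs_mul, abs_of_pos (by positivity : 0 < (2 * T)⁻¹),
      ← intervalIntegral.integral_sub (Continuous.intervalIntegrable (by fun_prop) _ _)
        (Continuous.intervalIntegrable (by fun_prop) _ _)]
    have : ‖∫ t in -T..T, (F (v * b t) - F (1 * b t))‖ ≤ ε / 2 * |T - -T| := by
      refine intervalIntegral.norm_integral_le_of_norm_le_const fun r _ => ?_
      rw [one_mul, mul_comm]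
      exact (hω (b r)).le
    rw [Real.norm_eq_abs, abs_of_pos (by linarith : 0 < T - -T)] at this
    calc _ ≤ (2 * T)⁻¹ * (ε / 2 * (T - -T)) := by gcongr
      _ = _ := by field_simp; ring
  have h3 := abs_flowMean_mul_sub_le hF hb hadd hC hT0 t v
  rw [hω']
  have h4 := hT t ht
  have h5 := abs_sub_le (flowMean F b T (b t * v)) (flowMean F b T v) (flowMean F b T 1)
  linarith

variable [MeasurableSpace G] [BorelSpace G] (μ : Measure G) [μ.IsHaarMeasure]
  [IsProbabilityMeasure μ]

theorem integral_flowMean {F : G → ℝ} (hF : Continuous F) {b : ℝ → G} (hb : Continuous b)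
    {T : ℝ} (hT : 0 < T) : ∫ ω, flowMean F b T ω ∂μ = ∫ ω, F ω ∂μ := by
  obtain ⟨C, hC⟩ := isCompact_univ.exists_bound_of_continuousOn hF.continuousOn
  have hint : Integrable (fun p : G × ℝ => F (p.1 * b p.2))
      (μ.prod (volume.restrict (Set.Ioc (-T) T))) := by
    have hc : Continuous fun p : G × ℝ => F (p.1 * b p.2) := by fun_prop
    exact Integrable.of_bound hc.aestronglyMeasurable C
      (Eventually.of_forall fun p => hC _ (Set.mem_univ _))
  simp only [flowMean, intervalIntegral.integral_of_le (by linarith : -T ≤ T)]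
  rw [integral_const_mul, integral_integral_swap hint]
  simp only [integral_mul_right_eq_self, integral_const]
  simp
  field_simp
  rw [max_eq_left (by linarith)]
  ring

/-- Unique ergodicity of a dense one-parameter flow on a compact abelian group. -/
theorem tendsto_flowMean {F : G → ℝ} (hF : Continuous F) {b : ℝ → G} (hb : Continuous b)
    (hadd : ∀ s t, b (s + t) = b s * b t) (hd : DenseRange b) (ω : G) :
    Tendsto (fun T => flowMean F b T ω) atTop (𝓝 (∫ x, F x ∂μ)) := by
  obtain ⟨C, hC⟩ := isCompact_univ.exists_bound_of_continuousOn hF.continuousOn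
  rw [Metric.tendsto_nhds]
  intro ε hε
  -- Two means are compared through the mean at `1`, so `ε / 4` is used twice. A mean that is almost
  -- constant in the base point is close to its own integral, which is `∫ F`.
  filter_upwards [eventually_forall_abs_flowMean_sub_lt hF hb hadd hd (half_pos (half_pos hε)),
    eventually_gt_atTop 0] with T hT hT0
  have hcont : AEStronglyMeasurable (fun x => flowMean F b T x) μ := by
    refine (StronglyMeasurable.const_mul ?_ _).aestronglyMeasurable
    simp only [intervalIntegral.integral_of_le (by linarith : -T ≤ T)]
    have hc : Continuous fun p : G × ℝ => F (p.1 * b p.2) := by fun_prop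
    exact hc.stronglyMeasurable.integral_prod_right
  have hbd : ∀ x, ‖flowMean F b T x - flowMean F b T ω‖ ≤ ε / 2 := fun x => by
    have h1 := hT x
    have h2 := hT ω
    rw [Real.norm_eq_abs]
    rw [abs_lt] at h1 h2
    exact abs_le.2 ⟨by linarith, by linarith⟩
  have hint : Integrable (fun x => flowMean F b T x) μ := by
    refine Integrable.of_bound hcont (‖flowMean F b T ω‖ + ε / 2) (Eventually.of_forall fun x => ?_)
    calc ‖flowMean F b T x‖ = ‖flowMean F b T ω + (flowMean F b T x - flowMean F b T ω)‖ := by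
          congr 1; ring
      _ ≤ _ := (norm_add_le _ _).trans (by linarith [hbd x])
  have h := norm_integral_le_of_norm_le_const (μ := μ) (Eventually.of_forall hbd)
  rw [integral_sub hint (integrable_const _), integral_flowMean μ hF hb hT0] at h
  simp only [integral_const, probReal_univ, one_smul, mul_one] at h
  rw [dist_comm, Real.dist_eq]
  rw [Real.norm_eq_abs] at h
  linarith

end UniqueErgodicity

/-! ### The maximal ergodic theorem -/

section MaximalErgodic

variable {α : Type*}

/-- The largest excess `∑_{k < j} (F ∘ T^k - ε)` over `j ≤ n`, or `0` if all are negative. -/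
noncomputable def maximalExcess (F : α → ℝ≥0∞) (T : α → α) (ε : ℝ≥0∞) : ℕ → α → ℝ≥0∞
  | 0 => fun _ => 0
  | n + 1 => fun x => F x + maximalExcess F T ε n (T x) - ε

theorem maximalExcess_mono (F : α → ℝ≥0∞) (T : α → α) (ε : ℝ≥0∞) :
    Monotone (maximalExcess F T ε) := by
  refine monotone_nat_of_le_succ fun n => ?_
  induction n with
  | zero => exact fun x => zero_le
  | succ n ih => exact fun x => tsub_le_tsub_right (add_le_add_right (ih (T x)) _) ε

theorem sum_iterate_le_maximalExcess_add (F : α → ℝ≥0∞) (T : α → α) (ε : ℝ≥0∞) (n : ℕ) (x : α) :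
    ∑ k ∈ Finset.range n, F (T^[k] x) ≤ maximalExcess F T ε n x + n * ε := by
  induction n generalizing x with
  | zero => simp
  | succ n ih =>
    rw [Finset.sum_range_succ']
    simp only [Function.iterate_succ_apply, Function.iterate_zero, id_eq]
    calc _ ≤ (maximalExcess F T ε n (T x) + n * ε) + F x := by gcongr; exact ih (T x)
      _ = (F x + maximalExcess F T ε n (T x)) + n * ε := by ring
      _ ≤ ((F x + maximalExcess F T ε n (T x) - ε) + ε) + n * ε := by gcongr ?_ + _; exact le_tsub_add
      _ = _ := by simp only [maximalExcess]; push_cast; ring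

variable [MeasurableSpace α]

theorem measurable_maximalExcess {F : α → ℝ≥0∞} (hF : Measurable F) {T : α → α}
    (hT : Measurable T) (ε : ℝ≥0∞) (n : ℕ) : Measurable (maximalExcess F T ε n) := by
  induction n with
  | zero => exact measurable_const
  | succ n ih => exact (hF.add (ih.comp hT)).sub_const ε

variable {μ : Measure α} [IsProbabilityMeasure μ]

/-- Garsia's argument: where the excess `M (n + 1)` is positive, adding `ε` to it gives exactly `F +
M n ∘ T`; elsewhere it is `0`. Integrating, with `T` measure preserving and `M n ≤ M (n + 1)`, the
finite integral of `M (n + 1)` cancels. -/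
theorem mul_measure_maximalExcess_pos_le {F : α → ℝ≥0∞} (hF : Measurable F) {T : α → α}
    (hT : MeasurePreserving T μ μ) (ε : ℝ≥0∞) (n : ℕ) :
    ε * μ {x | 0 < maximalExcess F T ε n x} ≤ ∫⁻ x, F x ∂μ := by
  rcases eq_or_ne (∫⁻ x, F x ∂μ) ∞ with h | hFin
  · simp [h]
  have hm := measurable_maximalExcess hF hT.measurable ε
  have hfin : ∀ n, ∫⁻ x, maximalExcess F T ε n x ∂μ ≠ ∞ := by
    intro n
    induction n with
    | zero => simp [maximalExcess]
    | succ n ih =>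
      refine ne_top_of_le_ne_top (ENNReal.add_ne_top.2 ⟨hFin, ih⟩) ?_
      calc _ ≤ ∫⁻ x, (F x + maximalExcess F T ε n (T x)) ∂μ :=
            lintegral_mono fun x => tsub_le_self
        _ = _ := by rw [lintegral_add_left hF, hT.lintegral_comp (hm n)]
  cases n with
  | zero => simp [maximalExcess]
  | succ n =>
    have hs : MeasurableSet {x | 0 < maximalExcess F T ε (n + 1) x} :=
      measurableSet_lt measurable_const (hm _)
    have h1 : ∀ x, maximalExcess F T ε (n + 1) x +
        {x | 0 < maximalExcess F T ε (n + 1) x}.indicator (fun _ => ε) x ≤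
        F x + maximalExcess F T ε n (T x) := by
      intro x
      by_cases hx : 0 < maximalExcess F T ε (n + 1) x
      · rw [Set.indicator_of_mem (by exact hx)]
        exact (tsub_add_cancel_of_le (tsub_pos_iff_lt.1 hx).le).le
      · rw [Set.indicator_of_notMem (by exact hx), not_lt.1 hx |> le_zero_iff.1]
        simp
    have h2 := lintegral_mono (μ := μ) h1
    rw [lintegral_add_left (hm _), lintegral_indicator hs, setLIntegral_const,
      lintegral_add_left hF, hT.lintegral_comp (hm n)] at h2
    have h3 := h2.trans (add_le_add_right
      (lintegral_mono (maximalExcess_mono F T ε n.le_succ)) _)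
    rw [add_comm (∫⁻ x, F x ∂μ)] at h3
    exact (ENNReal.add_le_add_iff_left (hfin _)).1 h3

/-- The maximal ergodic theorem for non-negative functions. -/
theorem mul_measure_exists_lt_sum_iterate_le {F : α → ℝ≥0∞} (hF : Measurable F) {T : α → α}
    (hT : MeasurePreserving T μ μ) (ε : ℝ≥0∞) :
    ε * μ {x | ∃ n : ℕ, n * ε < ∑ k ∈ Finset.range n, F (T^[k] x)} ≤ ∫⁻ x, F x ∂μ := by
  have hsub : {x | ∃ n : ℕ, n * ε < ∑ k ∈ Finset.range n, F (T^[k] x)} ⊆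
      ⋃ n, {x | 0 < maximalExcess F T ε n x} := by
    rintro x ⟨n, hn⟩
    refine Set.mem_iUnion.2 ⟨n, Set.mem_ofPred_eq ▸ pos_iff_ne_zero.2 fun h0 => ?_⟩
    have := sum_iterate_le_maximalExcess_add F T ε n x
    rw [h0, zero_add] at this
    exact absurd hn this.not_gt
  have hmono : Monotone fun n => {x | 0 < maximalExcess F T ε n x} :=
    fun m n hmn x hx => lt_of_lt_of_le hx (maximalExcess_mono F T ε hmn x)
  calc _ ≤ ε * μ (⋃ n, {x | 0 < maximalExcess F T ε n x}) := by gcongr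
    _ = ⨆ n, ε * μ {x | 0 < maximalExcess F T ε n x} := by
        rw [hmono.measure_iUnion, ENNReal.mul_iSup]
    _ ≤ _ := iSup_le fun n => mul_measure_maximalExcess_pos_le hF hT ε n

end MaximalErgodic

/-! ### The pointwise ergodic theorem for the flow -/

section PointwiseErgodic

theorem sum_range_lintegral_Ioc_eq {F : ℝ → ℝ≥0∞} (n : ℕ) :
    ∑ k ∈ Finset.range n, ∫⁻ t in Set.Ioc (0 : ℝ) 1, F (k + t) = ∫⁻ t in Set.Ioc (0 : ℝ) n, F t := by
  induction n with
  | zero => simp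
  | succ n ih =>
    rw [Finset.sum_range_succ, ih]
    have h1 : ∫⁻ t in Set.Ioc (0 : ℝ) 1, F (n + t) = ∫⁻ t in Set.Ioc (n : ℝ) (n + 1), F t := by
      have := (measurePreserving_add_left (volume : Measure ℝ) (n : ℝ)).setLIntegral_comp_preimage_emb
        (MeasurableEquiv.addLeft (n : ℝ)).measurableEmbedding F (Set.Ioc (n : ℝ) (n + 1))
      simpa using this
    have h2 : Set.Ioc (0 : ℝ) ((n + 1 : ℕ) : ℝ) = Set.Ioc (0 : ℝ) n ∪ Set.Ioc (n : ℝ) (n + 1) := by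
      rw [Set.Ioc_union_Ioc_eq_Ioc (by positivity) (by linarith)]; push_cast; rfl
    rw [h1, h2, lintegral_union measurableSet_Ioc]
    exact Set.Ioc_disjoint_Ioc_of_le le_rfl

variable {G : Type*} [CommGroup G]

/-- The mean of `F` over the orbit segment `{ω * b t : |t| ≤ T}`, for `F` with values in `[0, ∞]`. -/
noncomputable def flowLMean (F : G → ℝ≥0∞) (b : ℝ → G) (T : ℝ) (ω : G) : ℝ≥0∞ :=
  ENNReal.ofReal (1 / (2 * T)) * ∫⁻ t in Set.Icc (-T) T, F (ω * b t)

/-- With `n = ⌈T⌉₊` the window lies in `[-n, n]`, where the integral is at most `2 * n * ε`; since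
`T ≥ 1`, `n ≤ 2 * T`. -/
theorem flowLMean_le_of_forall_lintegral_Ioc_le {F : G → ℝ≥0∞} {b : ℝ → G} {ω : G} {ε : ℝ≥0∞}
    (h1 : ∀ n : ℕ, ∫⁻ t in Set.Ioc (0 : ℝ) n, F (ω * b t) ≤ n * ε)
    (h2 : ∀ n : ℕ, ∫⁻ t in Set.Ioc (0 : ℝ) n, F (ω * b (-t)) ≤ n * ε) {T : ℝ} (hT : 1 ≤ T) :
    flowLMean F b T ω ≤ 2 * ε := by
  set n := ⌈T⌉₊ with hn
  have hTn : T ≤ n := Nat.le_ceil T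
  have hn2 : (n : ℝ) ≤ 2 * T := by linarith [(Nat.ceil_lt_add_one (by linarith : 0 ≤ T)).le]
  have h3 : ∫⁻ t in Set.Ico (-n : ℝ) 0, F (ω * b t) ≤ n * ε := by
    refine le_trans (le_of_eq ?_) (h2 n)
    have := (Measure.measurePreserving_neg (volume : Measure ℝ)).setLIntegral_comp_preimage_emb
      (MeasurableEquiv.neg ℝ).measurableEmbedding (fun t => F (ω * b t)) (Set.Ico (-n : ℝ) 0)
    rw [← this]
    congr 2
    ext x
    simp [and_comm]
  have h4 : ∫⁻ t in Set.Icc (-T) T, F (ω * b t) ≤ n * ε + n * ε := by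
    calc _ ≤ ∫⁻ t in Set.Ico (-n : ℝ) 0 ∪ ({0} ∪ Set.Ioc (0 : ℝ) n), F (ω * b t) := by
          refine lintegral_mono_set fun t ht => ?_
          rcases lt_trichotomy t 0 with h | h | h
          · exact Or.inl ⟨by linarith [ht.1], h⟩
          · exact Or.inr (Or.inl h)
          · exact Or.inr (Or.inr ⟨h, by linarith [ht.2]⟩)
      _ ≤ _ + ((∫⁻ t in {(0 : ℝ)}, F (ω * b t)) + ∫⁻ t in Set.Ioc (0 : ℝ) n, F (ω * b t)) :=
          (lintegral_union_le _ _ _).trans (add_le_add_right (lintegral_union_le _ _ _) _)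
      _ ≤ _ := by
          refine add_le_add h3 ?_
          simpa only [Measure.restrict_singleton, Real.volume_singleton, zero_smul,
            lintegral_zero_measure, zero_add] using h1 n
  calc _ ≤ ENNReal.ofReal (1 / (2 * T)) * (n * ε + n * ε) := by rw [flowLMean]; gcongr
    _ = (ENNReal.ofReal (1 / (2 * T)) * n) * (2 * ε) := by ring
    _ ≤ 1 * (2 * ε) := by
        gcongr
        rw [← ENNReal.ofReal_natCast, ← ENNReal.ofReal_mul (by positivity), ← ENNReal.ofReal_one]
        refine ENNReal.ofReal_le_ofReal ?_
        rw [one_div, inv_mul_le_iff₀ (by positivity)]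
        linarith
    _ = _ := one_mul _

variable [TopologicalSpace G] [IsTopologicalGroup G]

theorem flowLMean_coe {F : G → NNReal} (hF : Continuous F) {b : ℝ → G} (hb : Continuous b)
    {T : ℝ} (hT : 0 < T) (ω : G) :
    flowLMean (fun x => (F x : ℝ≥0∞)) b T ω =
      ENNReal.ofReal (flowMean (fun x => (F x : ℝ)) b T ω) := by
  have hc : Continuous fun t => (F (ω * b t) : ℝ) := by fun_prop
  rw [flowLMean, flowMean, ENNReal.ofReal_mul (by positivity), one_div,
    intervalIntegral.integral_of_le (by linarith), ← integral_Icc_eq_integral_Ioc,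
    ofReal_integral_eq_lintegral_ofReal (hc.integrableOn_Icc)
      (Eventually.of_forall fun t => NNReal.coe_nonneg _)]
  simp only [ENNReal.ofReal_coe_nnreal]

variable [MeasurableSpace G] [BorelSpace G]

variable (μ : Measure G) [μ.IsHaarMeasure] [IsProbabilityMeasure μ]

/-- The discrete theorem is applied to translation by `b 1` and to the integral of `F` over a unit
piece of orbit. Its Birkhoff sums are the integrals over `(0, n]`, and by invariance its integral is
that of `F`. -/
theorem mul_measure_exists_lt_lintegral_Ioc_le {F : G → ℝ≥0∞} (hF : Measurable F) {b : ℝ → G}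
    (hb : Continuous b) (hadd : ∀ s t, b (s + t) = b s * b t) (ε : ℝ≥0∞) :
    ε * μ {ω | ∃ n : ℕ, n * ε < ∫⁻ t in Set.Ioc (0 : ℝ) n, F (ω * b t)} ≤ ∫⁻ ω, F ω ∂μ := by
  have hjoint : Measurable fun p : G × ℝ => F (p.1 * b p.2) :=
    hF.comp (by fun_prop : Continuous fun p : G × ℝ => p.1 * b p.2).measurable
  have hF1 : Measurable fun ω => ∫⁻ t in Set.Ioc (0 : ℝ) 1, F (ω * b t) :=
    hjoint.lintegral_prod_right'
  have h := mul_measure_exists_lt_sum_iterate_le (μ := μ) hF1 (measurePreserving_mul_right μ (b 1)) ε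
  have hit : ∀ (k : ℕ) ω, (fun x => x * b 1)^[k] ω = ω * b k := by
    intro k
    induction k with
    | zero =>
      intro ω
      have : b 0 = 1 := by simpa using hadd 0 0
      simp [this]
    | succ k ih =>
      intro ω
      rw [Function.iterate_succ_apply, ih]
      push_cast
      rw [add_comm, hadd, mul_assoc]
  simp only [hit] at h
  have hsum : ∀ (n : ℕ) ω, ∑ k ∈ Finset.range n, ∫⁻ t in Set.Ioc (0 : ℝ) 1, F (ω * b k * b t) =
      ∫⁻ t in Set.Ioc (0 : ℝ) n, F (ω * b t) := by
    intro n ω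
    rw [← sum_range_lintegral_Ioc_eq]
    simp only [hadd, mul_assoc]
  simp only [hsum] at h
  refine h.trans_eq ?_
  rw [lintegral_lintegral_swap hjoint.aemeasurable]
  simp only [lintegral_mul_right_eq_self]
  simp

theorem mul_measure_exists_lt_flowLMean_le {F : G → ℝ≥0∞} (hF : Measurable F) {b : ℝ → G}
    (hb : Continuous b) (hadd : ∀ s t, b (s + t) = b s * b t) (ε : ℝ≥0∞) :
    ε * μ {ω | ∃ T : ℝ, 1 ≤ T ∧ 2 * ε < flowLMean F b T ω} ≤ 2 * ∫⁻ ω, F ω ∂μ := by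
  set A := {ω | ∃ n : ℕ, n * ε < ∫⁻ t in Set.Ioc (0 : ℝ) n, F (ω * b t)}
  set B := {ω | ∃ n : ℕ, n * ε < ∫⁻ t in Set.Ioc (0 : ℝ) n, F (ω * b (-t))}
  have hA := mul_measure_exists_lt_lintegral_Ioc_le μ hF hb hadd ε
  have hB := mul_measure_exists_lt_lintegral_Ioc_le μ hF (b := fun t => b (-t)) (by fun_prop)
    (fun s t => by rw [neg_add, hadd]) ε
  have hsub : {ω | ∃ T : ℝ, 1 ≤ T ∧ 2 * ε < flowLMean F b T ω} ⊆ A ∪ B := by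
    rintro ω ⟨T, hT, h⟩
    by_contra hω
    simp only [A, B, Set.mem_union, Set.mem_ofPred_eq, not_or, not_exists, not_lt] at hω
    exact absurd h (flowLMean_le_of_forall_lintegral_Ioc_le hω.1 hω.2 hT).not_gt
  calc _ ≤ ε * (μ A + μ B) := by gcongr; exact (measure_mono hsub).trans (measure_union_le _ _)
    _ ≤ _ := by rw [mul_add, two_mul]; exact add_le_add hA hB

variable [CompactSpace G]

theorem tendsto_flowLMean_coe {F : G → NNReal} (hF : Continuous F) {b : ℝ → G} (hb : Continuous b)
    (hadd : ∀ s t, b (s + t) = b s * b t) (hd : DenseRange b) (ω : G) :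
    Tendsto (fun T => flowLMean (fun x => (F x : ℝ≥0∞)) b T ω) atTop (𝓝 (∫⁻ x, F x ∂μ)) := by
  have h := ENNReal.tendsto_ofReal (tendsto_flowMean μ (F := fun x => (F x : ℝ)) (by fun_prop)
    hb hadd hd ω)
  obtain ⟨C, hC⟩ := isCompact_univ.exists_bound_of_continuousOn
    (by fun_prop : ContinuousOn (fun x => (F x : ℝ)) Set.univ)
  have hint : Integrable (fun x => (F x : ℝ)) μ :=
    Integrable.of_bound (by fun_prop : Continuous fun x => (F x : ℝ)).measurable.aestronglyMeasurable
      C (Eventually.of_forall fun p => hC _ (Set.mem_univ _))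
  rw [ofReal_integral_eq_lintegral_ofReal hint
    (Eventually.of_forall fun t => NNReal.coe_nonneg _)] at h
  simp only [ENNReal.ofReal_coe_nnreal] at h
  refine h.congr' ?_
  filter_upwards [eventually_gt_atTop 0] with T hT using (flowLMean_coe hF hb hT ω).symm

/-- The pointwise ergodic theorem for a dense one-parameter flow on a compact abelian group and an
integrable supremum of an increasing sequence of continuous functions. -/
theorem ae_tendsto_flowLMean_iSup {F : ℕ → G → NNReal} (hF : ∀ M, Continuous (F M))
    (hmono : Monotone F) (hfin : ∫⁻ x, ⨆ M, (F M x : ℝ≥0∞) ∂μ ≠ ∞) {b : ℝ → G}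
    (hb : Continuous b) (hadd : ∀ s t, b (s + t) = b s * b t) (hd : DenseRange b) :
    ∀ᵐ ω ∂μ, Tendsto (fun T => flowLMean (fun x => ⨆ M, (F M x : ℝ≥0∞)) b T ω) atTop
      (𝓝 (∫⁻ x, ⨆ M, (F M x : ℝ≥0∞) ∂μ)) := by
  set Φ : G → ℝ≥0∞ := fun x => ⨆ M, (F M x : ℝ≥0∞) with hΦ
  have hFm : ∀ M, Measurable fun x => (F M x : ℝ≥0∞) := fun M =>
    (hF M).measurable.coe_nnreal_ennreal
  have hΦm : Measurable Φ := Measurable.iSup hFm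
  have hle : ∀ M x, (F M x : ℝ≥0∞) ≤ Φ x := fun M x => le_iSup (fun M => (F M x : ℝ≥0∞)) M
  have hsup : ∫⁻ x, Φ x ∂μ = ⨆ M, ∫⁻ x, F M x ∂μ :=
    lintegral_iSup hFm fun M N h x => ENNReal.coe_le_coe.2 (hmono h x)
  have hFfin : ∀ M, ∫⁻ x, F M x ∂μ ≠ ∞ := fun M =>
    ne_top_of_le_ne_top hfin (lintegral_mono (hle M))
  have hsmall : ∀ ε : ℝ≥0∞, ε ≠ 0 → ∃ M, ∫⁻ x, (Φ x - F M x) ∂μ ≤ ε := by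
    intro ε hε
    rcases eq_or_ne (∫⁻ x, Φ x ∂μ) 0 with h0 | h0
    · refine ⟨0, (lintegral_mono fun x => tsub_le_self).trans ?_⟩
      rw [h0]; exact zero_le
    obtain ⟨M, hM⟩ := lt_iSup_iff.1 (hsup ▸ ENNReal.sub_lt_self hfin h0 hε)
    refine ⟨M, ?_⟩
    rw [lintegral_sub (hFm M) (hFfin M) (Eventually.of_forall (hle M))]
    exact tsub_le_iff_left.2 (tsub_le_iff_right.1 (hsup ▸ hM.le))
  have hbad : ∀ ε : ℝ≥0∞, ε ≠ 0 → ε ≠ ∞ → ∀ᵐ ω ∂μ, ∃ M, ∀ T : ℝ, 1 ≤ T →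
      flowLMean (fun x => Φ x - F M x) b T ω ≤ 2 * ε := by
    intro ε hε hε'
    rw [ae_iff]
    refine le_zero_iff.1 (ENNReal.le_of_forall_pos_le_add fun δ hδ _ => ?_)
    -- The tolerance is such that the maximal inequality, with its factor `2`, leaves an exceptional
    -- set of measure at most `δ` after cancelling `ε`.
    obtain ⟨M, hM⟩ := hsmall (ε * δ / 2) (by simp [hε, hδ.ne'])
    have h1 := mul_measure_exists_lt_flowLMean_le μ (hΦm.sub (hFm M)) hb hadd ε
    have h2 : {ω | ¬∃ M, ∀ T : ℝ, 1 ≤ T → flowLMean (fun x => Φ x - F M x) b T ω ≤ 2 * ε} ⊆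
        {ω | ∃ T : ℝ, 1 ≤ T ∧ 2 * ε < flowLMean (fun x => Φ x - F M x) b T ω} := by
      intro ω hω
      simp only [Set.mem_ofPred_eq, not_exists, not_forall, not_le] at hω ⊢
      obtain ⟨T, h, h'⟩ := hω M
      exact ⟨T, h, h'⟩
    rw [zero_add]
    refine (measure_mono h2).trans ?_
    have h3 : ε * μ {ω | ∃ T : ℝ, 1 ≤ T ∧ 2 * ε < flowLMean (fun x => Φ x - F M x) b T ω} ≤
        ε * δ := by
      refine h1.trans ((mul_le_mul_right hM 2).trans_eq ?_)
      rw [ENNReal.mul_div_cancel (by norm_num) (by norm_num)]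
    exact (ENNReal.mul_le_mul_iff_right hε hε').1 h3
  have hbad' : ∀ᵐ ω ∂μ, ∀ j : ℕ, ∃ M, ∀ T : ℝ, 1 ≤ T →
      flowLMean (fun x => Φ x - F M x) b T ω ≤ 2 * ((j + 1 : ℕ) : ℝ≥0∞)⁻¹ :=
    ae_all_iff.2 fun j => hbad _ (by simp) (by simp)
  filter_upwards [hbad'] with ω hω
  -- From below, `F M ≤ Φ` and the means of `F M` converge on every orbit. From above, `Φ ≤ F M + (Φ
  -- - F M)`, and the means of the second term are uniformly small on the orbit of `ω`.
  refine tendsto_order.2 ⟨fun a ha => ?_, fun a ha => ?_⟩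
  · rw [hsup] at ha
    obtain ⟨M, hM⟩ := lt_iSup_iff.1 ha
    filter_upwards [(tendsto_flowLMean_coe μ (hF M) hb hadd hd ω).eventually_const_lt hM] with T hT
    refine hT.trans_le ?_
    unfold flowLMean
    gcongr
    exact hle M _
  · obtain ⟨j, hj⟩ : ∃ j : ℕ, ∫⁻ x, Φ x ∂μ + 2 * ((j + 1 : ℕ) : ℝ≥0∞)⁻¹ < a := by
      have h1 : Tendsto (fun j : ℕ => ∫⁻ x, Φ x ∂μ + 2 * ((j + 1 : ℕ) : ℝ≥0∞)⁻¹) atTop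
          (𝓝 (∫⁻ x, Φ x ∂μ + 2 * 0)) :=
        tendsto_const_nhds.add (ENNReal.Tendsto.const_mul
          (ENNReal.tendsto_inv_nat_nhds_zero.comp (tendsto_add_atTop_nat 1)) (Or.inr (by simp)))
      rw [mul_zero, add_zero] at h1
      exact (h1.eventually_lt_const ha).exists
    obtain ⟨M, hM⟩ := hω j
    have h2 := (tendsto_flowLMean_coe μ (hF M) hb hadd hd ω).add
      (tendsto_const_nhds (x := 2 * ((j + 1 : ℕ) : ℝ≥0∞)⁻¹))
    have h3 : ∫⁻ x, F M x ∂μ + 2 * ((j + 1 : ℕ) : ℝ≥0∞)⁻¹ < a :=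
      lt_of_le_of_lt (by gcongr; exact hle M _) hj
    filter_upwards [h2.eventually_lt_const h3, eventually_ge_atTop 1] with T hT hT1
    refine lt_of_le_of_lt ?_ hT
    refine le_trans ?_ (add_le_add_right (hM T hT1) _)
    unfold flowLMean
    have hm : Measurable fun t => (F M (ω * b t) : ℝ≥0∞) :=
      (hFm M).comp (by fun_prop : Continuous fun t => ω * b t).measurable
    rw [← mul_add, ← lintegral_add_left hm]
    gcongr
    exact le_add_tsub

end PointwiseErgodic

/-! ### Common eigenvectors of commuting operators -/

section CommonEigenvector

/-- Commuting endomorphisms have a common eigenvector in each non-zero finite-dimensional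
invariant subspace. -/
theorem exists_common_eigenvector {ι 𝕜 X : Type*} [Field 𝕜] [IsAlgClosed 𝕜] [AddCommGroup X]
    [Module 𝕜 X] (f : ι → Module.End 𝕜 X) (hcomm : ∀ i j x, f i (f j x) = f j (f i x))
    (W : Submodule 𝕜 X) [FiniteDimensional 𝕜 W] (hW : W ≠ ⊥) (hinv : ∀ i, ∀ x ∈ W, f i x ∈ W) :
    ∃ v ∈ W, v ≠ 0 ∧ ∀ i, ∃ c : 𝕜, f i v = c • v := by
  induction hn : Module.finrank 𝕜 W using Nat.strong_induction_on generalizing W with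
  | _ n ih =>
  subst hn
  by_cases hsc : ∀ i, ∃ c : 𝕜, ∀ x ∈ W, f i x = c • x
  · obtain ⟨v, hv, hv0⟩ := W.ne_bot_iff.1 hW
    refine ⟨v, hv, hv0, fun i => ?_⟩
    obtain ⟨c, hc⟩ := hsc i
    exact ⟨c, hc v hv⟩
  · push Not at hsc
    obtain ⟨i, hi⟩ := hsc
    have : Nontrivial W := Submodule.nontrivial_iff_ne_bot.2 hW
    obtain ⟨c, hc⟩ := Module.End.exists_eigenvalue ((f i).restrict (hinv i))
    obtain ⟨v, hv⟩ := hc.exists_hasEigenvector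
    -- As `f i` is not scalar on `W`, its eigenspace in `W` is a proper non-zero subspace, invariant
    -- under all `f j` by commutativity, and the induction applies to it.
    set W' := W ⊓ (f i).eigenspace c with hW'
    have hvi : f i v = c • (v : X) := by
      simpa using congrArg Subtype.val hv.apply_eq_smul
    have hvW' : (v : X) ∈ W' := ⟨v.2, Module.End.mem_eigenspace_iff.2 hvi⟩
    have hlt : W' < W := by
      refine lt_of_le_of_ne inf_le_left fun h => ?_
      obtain ⟨x, hx, hxc⟩ := hi c
      exact hxc (Module.End.mem_eigenspace_iff.1 (h ▸ hx : x ∈ W').2)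
    have : FiniteDimensional 𝕜 W' := Submodule.finiteDimensional_of_le hlt.le
    obtain ⟨w, hw, h⟩ := ih _ (Submodule.finrank_lt_finrank_of_lt hlt) W'
      (W'.ne_bot_iff.2 ⟨v, hvW', fun h => hv.2 (Subtype.ext h)⟩)
      (fun j x hx => ⟨hinv j x hx.1, Module.End.mem_eigenspace_iff.2 (by
        rw [hcomm, Module.End.mem_eigenspace_iff.1 hx.2, map_smul])⟩) rfl
    exact ⟨w, hlt.le hw, h⟩

end CommonEigenvector

/-! ### Non-zero spectrum and compact operators -/

section SpectralRadius

variable {X : Type*} [NormedAddCommGroup X] [NormedSpace ℂ X] [CompleteSpace X]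

/-- If `0` were the only point of the spectrum, Gelfand's formula would make `‖A ^ n‖` eventually
smaller than `(r / 2) ^ n`, hence smaller than `c * r ^ n`. -/
theorem exists_ne_zero_mem_spectrum_of_le_norm_pow [Nontrivial X] (A : X →L[ℂ] X) {c r : ℝ}
    (hc : 0 < c) (hr : 0 < r) (h : ∀ n : ℕ, c * r ^ n ≤ ‖A ^ n‖) : ∃ z ∈ spectrum ℂ A, z ≠ 0 := by
  obtain ⟨z, hz, hzr⟩ := spectrum.exists_nnnorm_eq_spectralRadius A
  refine ⟨z, hz, fun hz0 => ?_⟩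
  have ht := spectrum.pow_nnnorm_pow_one_div_tendsto_nhds_spectralRadius A
  rw [← hzr, hz0, nnnorm_zero, ENNReal.coe_zero] at ht
  have hev := ht.eventually_lt_const (ENNReal.ofReal_pos.2 (half_pos hr))
  have hc2 : ∀ᶠ n : ℕ in atTop, (1 / 2 : ℝ) ^ n < c :=
    (tendsto_pow_atTop_nhds_zero_of_lt_one (by norm_num) (by norm_num)).eventually_lt_const hc
  obtain ⟨n, ⟨h1, h2⟩, h3⟩ := ((hev.and hc2).and (eventually_gt_atTop 0)).exists
  have hn : (0 : ℝ) < n := by exact_mod_cast h3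
  have h4 : (‖A ^ n‖₊ : ℝ≥0∞) < ENNReal.ofReal ((r / 2) ^ n) := by
    have := ENNReal.rpow_lt_rpow h1 hn
    rw [← ENNReal.rpow_mul, one_div_mul_cancel hn.ne', ENNReal.rpow_one] at this
    rwa [ENNReal.rpow_natCast, ← ENNReal.ofReal_pow (by positivity)] at this
  rw [← enorm_eq_nnnorm, ← ofReal_norm, ENNReal.ofReal_lt_ofReal_iff (by positivity)] at h4
  have h5 := h n
  rw [div_pow] at h4
  have h6 : (1 / 2 : ℝ) ^ n * r ^ n < c * r ^ n := by gcongr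
  rw [one_div, inv_pow] at h6
  have h7 : r ^ n / 2 ^ n = ((2 : ℝ) ^ n)⁻¹ * r ^ n := by ring
  linarith

/-- On the eigenspace the identity is `z⁻¹ • A`, hence compact. -/
theorem finiteDimensional_eigenspace_of_isCompactOperator {A : X →L[ℂ] X}
    (hA : IsCompactOperator A) {z : ℂ} (hz : z ≠ 0) :
    FiniteDimensional ℂ (Module.End.eigenspace A.toLinearMap z) := by
  have hclosed : IsClosed (Module.End.eigenspace A.toLinearMap z : Set X) := by
    have : (Module.End.eigenspace A.toLinearMap z : Set X) = {x | A x = z • x} := by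
      ext x; simp
    rw [this]
    exact isClosed_eq A.continuous (continuous_const_smul z)
  have : CompleteSpace (Module.End.eigenspace A.toLinearMap z) := hclosed.completeSpace_coe
  have h := IsCompactOperator.restrict' (f := A.toLinearMap) hA
    (V := Module.End.eigenspace A.toLinearMap z) fun v hv =>
      Module.End.mem_eigenspace_iff.2 (by
        rw [Module.End.mem_eigenspace_iff.1 hv, map_smul, Module.End.mem_eigenspace_iff.1 hv])
  refine FiniteDimensional.of_isCompactOperator_id (𝕜 := ℂ) ?_
  have he : (z⁻¹ • fun v => A.toLinearMap.restrict (fun v hv =>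
      Module.End.mem_eigenspace_iff.2 (by
        rw [Module.End.mem_eigenspace_iff.1 hv, map_smul, Module.End.mem_eigenspace_iff.1 hv])) v) =
      (id : Module.End.eigenspace A.toLinearMap z → _) := by
    refine funext fun v => Subtype.ext ?_
    have hv : A v = z • (v : X) := Module.End.mem_eigenspace_iff.1 v.2
    simp [hv, smul_smul, hz]
  exact he ▸ h.smul z⁻¹

end SpectralRadius

/-! ### Convolution operators on continuous functions -/

section Convolution

theorem Continuous.integrable_of_compactSpace {K E : Type*} [TopologicalSpace K] [CompactSpace K]
    [MeasurableSpace K] [OpensMeasurableSpace K] (μ : Measure K) [IsFiniteMeasure μ]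
    [NormedAddCommGroup E] {F : K → E} (hF : Continuous F) : Integrable F μ :=
  hF.integrable_of_hasCompactSupport (HasCompactSupport.of_compactSpace F)

variable {K : Type*} [CommGroup K] [TopologicalSpace K] [IsTopologicalGroup K]

/-- The translates `x ↦ φ (z⁻¹ * x)` of a continuous function, as a continuous function of `z`. -/
noncomputable def translates (φ : C(K, ℂ)) : C(K, C(K, ℂ)) :=
  ContinuousMap.curry ⟨fun p : K × K => φ (p.1⁻¹ * p.2), by fun_prop⟩

@[simp]
theorem translates_apply (φ : C(K, ℂ)) (z x : K) : translates φ z x = φ (z⁻¹ * x) := rfl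

variable [CompactSpace K]

theorem norm_translates_le (φ : C(K, ℂ)) (z : K) : ‖translates φ z‖ ≤ ‖φ‖ :=
  (ContinuousMap.norm_le _ (norm_nonneg _)).2 fun x => φ.norm_coe_le_norm (z⁻¹ * x)

variable [MeasurableSpace K] (μ : Measure K)

/-- The convolution `x ↦ ∫ D z * φ (z⁻¹ * x)` of an integrable and a continuous function. -/
noncomputable def convolve (D : K → ℂ) (φ : C(K, ℂ)) : C(K, ℂ) := ∫ z, D z • translates φ z ∂μ

section

variable [BorelSpace K]

theorem integrable_smul_translates {D : K → ℂ} (hD : Integrable D μ) (φ : C(K, ℂ)) :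
    Integrable (fun z => D z • translates φ z) μ := by
  have h1 : AEStronglyMeasurable (fun z => translates φ z) μ := by
    have := ((translates φ).continuous.continuousOn (s := Set.univ)).aestronglyMeasurable_of_isCompact
      (μ := μ) isCompact_univ MeasurableSet.univ
    rwa [Measure.restrict_univ] at this
  refine (hD.norm.mul_const ‖φ‖).mono' (hD.1.smul h1) (Eventually.of_forall fun z => ?_)
  rw [norm_smul]
  gcongr
  exact norm_translates_le φ z

end

theorem norm_convolve_le {D : K → ℂ} (hD : Integrable D μ) (φ : C(K, ℂ)) :
    ‖convolve μ D φ‖ ≤ (∫ z, ‖D z‖ ∂μ) * ‖φ‖ := by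
  rw [← integral_mul_const]
  refine norm_integral_le_of_norm_le (hD.norm.mul_const _) (Eventually.of_forall fun z => ?_)
  rw [norm_smul]
  gcongr
  exact norm_translates_le φ z

variable [BorelSpace K]

theorem map_convolve {D : K → ℂ} (hD : Integrable D μ) (φ : C(K, ℂ)) (L : C(K, ℂ) →L[ℂ] ℂ) :
    L (convolve μ D φ) = ∫ z, D z * L (translates φ z) ∂μ := by
  rw [convolve, ← L.integral_comp_comm (integrable_smul_translates μ hD φ)]
  simp

theorem convolve_apply {D : K → ℂ} (hD : Integrable D μ) (φ : C(K, ℂ)) (x : K) :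
    convolve μ D φ x = ∫ z, D z * φ (z⁻¹ * x) ∂μ :=
  map_convolve μ hD φ (ContinuousMap.evalCLM ℂ x)

variable [IsProbabilityMeasure μ]

/-- Convolution with a continuous function, as an operator on the continuous functions. -/
noncomputable def convolveCLM (H : C(K, ℂ)) : C(K, ℂ) →L[ℂ] C(K, ℂ) :=
  LinearMap.mkContinuous
    { toFun := convolve μ H
      map_add' := fun φ ψ => by
        have hH := H.continuous.integrable_of_compactSpace μ
        rw [convolve, convolve, convolve, ← integral_add (integrable_smul_translates μ hH φ)
          (integrable_smul_translates μ hH ψ)]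
        congr 1
        ext z x
        simp [mul_add]
      map_smul' := fun c φ => by
        rw [convolve, convolve, RingHom.id_apply, ← integral_smul]
        congr 1
        ext z x
        simp [mul_left_comm] }
    (∫ z, ‖H z‖ ∂μ) fun φ => norm_convolve_le μ (H.continuous.integrable_of_compactSpace μ) φ

theorem convolveCLM_apply (H φ : C(K, ℂ)) (x : K) :
    convolveCLM μ H φ x = ∫ z, H z * φ (z⁻¹ * x) ∂μ :=
  convolve_apply μ (H.continuous.integrable_of_compactSpace μ) φ x

theorem convolveCLM_translates (H φ : C(K, ℂ)) (z : K) :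
    convolveCLM μ H (translates φ z) = translates (convolveCLM μ H φ) z := by
  ext x
  simp only [convolveCLM_apply, translates_apply]
  congr 1
  ext y
  rw [mul_left_comm]

variable [μ.IsHaarMeasure] [μ.IsInvInvariant]

/-- The substitution moves the dependence on `x` from `φ` to `H`; this form yields equicontinuity
and the adjoint. -/
theorem convolveCLM_apply' (H φ : C(K, ℂ)) (x : K) :
    convolveCLM μ H φ x = ∫ y, H (x * y⁻¹) * φ y ∂μ := by
  rw [convolveCLM_apply, ← integral_div_left_eq_self _ μ x]
  congr 1
  ext y
  simp [div_eq_mul_inv]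

/-- Arzelà–Ascoli: the image of the unit ball is bounded, and it is equicontinuous because `H` is
uniformly continuous. -/
theorem isCompactOperator_convolveCLM (H : C(K, ℂ)) : IsCompactOperator (convolveCLM μ H) := by
  refine (isCompactOperator_iff_isCompact_closure_image_closedBall
    (convolveCLM μ H).toLinearMap one_pos).2 ?_
  set e := ContinuousMap.isometryEquivBoundedOfCompact K ℂ
  set S := (convolveCLM μ H).toLinearMap '' Metric.closedBall 0 1 with hS
  have key : IsCompact (closure (e '' S)) := by
    refine BoundedContinuousFunction.arzela_ascoli (Metric.closedBall 0 ‖convolveCLM μ H‖)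
      (isCompact_closedBall _ _) _ ?_ ?_
    · rintro _ x ⟨_, ⟨φ, hφ, rfl⟩, rfl⟩
      rw [mem_closedBall_zero_iff] at hφ ⊢
      calc ‖convolveCLM μ H φ x‖ ≤ ‖convolveCLM μ H φ‖ := ContinuousMap.norm_coe_le_norm _ x
        _ ≤ ‖convolveCLM μ H‖ * ‖φ‖ := ContinuousLinearMap.le_opNorm _ _
        _ ≤ ‖convolveCLM μ H‖ := mul_le_of_le_one_right (norm_nonneg _) hφ
    · intro x₀
      rw [Metric.equicontinuousAt_iff_right]
      intro ε hε
      have h1 := eventually_forall_norm_mul_sub_lt H.continuous (half_pos hε)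
      have h2 : Tendsto (fun x => x * x₀⁻¹) (𝓝 x₀) (𝓝 1) := by
        have : Continuous fun x => x * x₀⁻¹ := by fun_prop
        simpa using this.tendsto x₀
      filter_upwards [h2.eventually h1] with x hx
      rintro ⟨_, _, ⟨φ, hφ, rfl⟩, rfl⟩
      rw [mem_closedBall_zero_iff] at hφ
      change dist (convolveCLM μ H φ x₀) (convolveCLM μ H φ x) < ε
      have hint : ∀ x, Integrable (fun y => H (x * y⁻¹) * φ y) μ := fun x =>
        Continuous.integrable_of_compactSpace μ (by fun_prop)
      rw [dist_comm, dist_eq_norm, convolveCLM_apply', convolveCLM_apply',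
        ← integral_sub (hint _) (hint _)]
      refine lt_of_le_of_lt (norm_integral_le_of_norm_le_const (C := ε / 2)
        (Eventually.of_forall fun y => ?_)) (by simpa using hε)
      rw [← sub_mul, norm_mul]
      have h3 := hx (x₀ * y⁻¹)
      rw [show x₀ * y⁻¹ * (x * x₀⁻¹) = x * y⁻¹ by
        rw [mul_mul_mul_comm, mul_comm x₀, mul_mul_mul_comm, mul_inv_cancel, mul_one]] at h3
      calc _ ≤ ε / 2 * 1 := by
            gcongr
            exact (φ.norm_coe_le_norm y).trans hφ
        _ = _ := mul_one _
  have h2 : e '' closure S = closure (e '' S) := e.toHomeomorph.image_closure S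
  rw [← h2] at key
  exact e.toHomeomorph.isCompact_image.1 key

theorem integral_convolveCLM_mul_conj {H : C(K, ℂ)}
    (hH : ∀ x, H x⁻¹ = (starRingEnd ℂ) (H x)) (φ ψ : C(K, ℂ)) :
    ∫ x, convolveCLM μ H φ x * (starRingEnd ℂ) (ψ x) ∂μ =
      ∫ x, φ x * (starRingEnd ℂ) (convolveCLM μ H ψ x) ∂μ := by
  have h1 : ∀ x, convolveCLM μ H φ x * (starRingEnd ℂ) (ψ x) =
      ∫ y, H (x * y⁻¹) * φ y * (starRingEnd ℂ) (ψ x) ∂μ := fun x => by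
    rw [convolveCLM_apply', integral_mul_const]
  have h2 : ∀ y, φ y * (starRingEnd ℂ) (convolveCLM μ H ψ y) =
      ∫ x, H (x * y⁻¹) * φ y * (starRingEnd ℂ) (ψ x) ∂μ := fun y => by
    rw [convolveCLM_apply', ← integral_conj, ← integral_const_mul]
    congr 1
    ext x
    rw [map_mul, ← hH]
    simp only [mul_inv_rev, inv_inv]
    ring
  simp only [h1, h2]
  refine integral_integral_swap_of_hasCompactSupport ?_ (HasCompactSupport.of_compactSpace _)
  simp only [Function.uncurry_def]
  fun_prop

/-- This is `‖φ - t A²φ‖² ≥ 0` in `L₂`, expanded with `⟨φ, A²φ⟩ = ‖Aφ‖²` for the symmetric operator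
`A`. It plays the part of Cauchy–Schwarz in the growth estimate for `‖Aⁿ H‖₂`. -/
theorem integral_sq_norm_sub_smul_convolveCLM_nonneg (H : C(K, ℂ)) (hH : ∀ x, H x⁻¹ = (starRingEnd ℂ) (H x)) (φ : C(K, ℂ))
    (t : ℝ) :
    0 ≤ (∫ x, ‖φ x‖ ^ 2 ∂μ) - 2 * t * (∫ x, ‖convolveCLM μ H φ x‖ ^ 2 ∂μ) +
      t ^ 2 * ∫ x, ‖convolveCLM μ H (convolveCLM μ H φ) x‖ ^ 2 ∂μ := by
  set A := convolveCLM μ H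
  have hI : ∀ f : C(K, ℂ), Integrable (fun x => ‖f x‖ ^ 2) μ := fun f =>
    Continuous.integrable_of_compactSpace μ (by fun_prop)
  have h1 : ∫ x, (φ x * (starRingEnd ℂ) (A (A φ) x)).re ∂μ = ∫ x, ‖A φ x‖ ^ 2 ∂μ := by
    have h2 := integral_convolveCLM_mul_conj μ hH φ (A φ)
    have h3 : Integrable (fun x => φ x * (starRingEnd ℂ) (A (A φ) x)) μ :=
      Continuous.integrable_of_compactSpace μ (by fun_prop)
    calc _ = (∫ x, φ x * (starRingEnd ℂ) (A (A φ) x) ∂μ).re := integral_re h3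
      _ = (∫ x, A φ x * (starRingEnd ℂ) (A φ x) ∂μ).re := by rw [← h2]
      _ = (∫ x, ((‖A φ x‖ ^ 2 : ℝ) : ℂ) ∂μ).re := by
          simp only [Complex.mul_conj, Complex.normSq_eq_norm_sq]
      _ = _ := by rw [integral_complex_ofReal, Complex.ofReal_re]
  rw [← h1]
  have h4 : Integrable (fun x => (φ x * (starRingEnd ℂ) (A (A φ) x)).re) μ :=
    Continuous.integrable_of_compactSpace μ (by fun_prop)
  rw [← integral_const_mul, ← integral_const_mul, ← integral_sub (hI _) (h4.const_mul _),
    ← integral_add (f := fun x => ‖φ x‖ ^ 2 - 2 * t * (φ x * (starRingEnd ℂ) (A (A φ) x)).re)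
      ((hI _).sub (h4.const_mul _)) ((hI _).const_mul _)]
  refine integral_nonneg fun x => ?_
  have h5 : ‖φ x - t * A (A φ) x‖ ^ 2 = ‖φ x‖ ^ 2 -
      2 * t * (φ x * (starRingEnd ℂ) (A (A φ) x)).re + t ^ 2 * ‖A (A φ) x‖ ^ 2 := by
    rw [← Complex.normSq_eq_norm_sq, ← Complex.normSq_eq_norm_sq, ← Complex.normSq_eq_norm_sq,
      Complex.normSq_apply, Complex.normSq_apply, Complex.normSq_apply]
    simp
    ring
  simp only [Pi.zero_apply]
  rw [← h5]
  positivity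

/-- The squared `L₂` norms `s n` of `Aⁿ H` grow at least like `r ^ n` with `r = s 1 / s 0 > 0`. The
sup norm dominates the `L₂` norm, so `‖A ^ n‖` grows geometrically too, the spectrum has a non-zero
point, and by compactness that point is an eigenvalue. -/
theorem exists_hasEigenvalue_convolveCLM {H : C(K, ℂ)}
    (hH : ∀ x, H x⁻¹ = (starRingEnd ℂ) (H x)) (hH0 : H ≠ 0) :
    ∃ z : ℂ, z ≠ 0 ∧ Module.End.HasEigenvalue (convolveCLM μ H).toLinearMap z := by
  set A := convolveCLM μ H with hA
  have hpos : ∀ f : C(K, ℂ), f ≠ 0 → 0 < ∫ x, ‖f x‖ ^ 2 ∂μ := by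
    intro f hf
    obtain ⟨x, hx⟩ : ∃ x, f x ≠ 0 := by
      by_contra h
      push Not at h
      exact hf (ContinuousMap.ext h)
    refine (by fun_prop : Continuous fun x => ‖f x‖ ^ 2).integral_pos_of_hasCompactSupport_nonneg_nonzero
      (HasCompactSupport.of_compactSpace _) (fun x => by positivity) (x := x) (by simpa using hx)
  -- For hermitian `H` the value of `H * H` at `1` is `∫ ‖H‖ ^ 2`.
  have hAH : A H ≠ 0 := by
    intro h
    have h1 : A H 1 = 0 := by rw [h]; rfl
    rw [hA, convolveCLM_apply] at h1
    simp only [mul_one, hH, Complex.mul_conj, Complex.normSq_eq_norm_sq] at h1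
    rw [integral_complex_ofReal] at h1
    exact (hpos H hH0).ne' (by exact_mod_cast h1)
  set s : ℕ → ℝ := fun n => ∫ x, ‖(A ^ n) H x‖ ^ 2 ∂μ with hs
  have hpow : ∀ n, (A ^ (n + 1)) H = A ((A ^ n) H) := fun n => by
    rw [pow_succ']; rfl
  have hs0 : 0 < s 0 := by simpa [hs] using hpos H hH0
  have hs1 : 0 < s 1 := by simpa [hs] using hpos _ hAH
  set r := s 1 / s 0 with hr
  have hr0 : 0 < r := div_pos hs1 hs0
  have hstep : ∀ n, r * s n ≤ s (n + 1) := by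
    intro n
    induction n with
    | zero => rw [hr, div_mul_cancel₀ _ hs0.ne']
    | succ n ih =>
      -- With `t = r⁻¹` this reads `s (n + 2) ≥ 2 r s (n + 1) - r² s n`, and `r s n ≤ s (n + 1)`
      -- turns the right side into at least `r s (n + 1)`.
      have h1 := integral_sq_norm_sub_smul_convolveCLM_nonneg μ H hH ((A ^ n) H) r⁻¹
      rw [← hA, ← hpow, ← hpow] at h1
      change 0 ≤ s n - 2 * r⁻¹ * s (n + 1) + r⁻¹ ^ 2 * s (n + 1 + 1) at h1
      have h2 : 0 ≤ r ^ 2 * (s n - 2 * r⁻¹ * s (n + 1) + r⁻¹ ^ 2 * s (n + 1 + 1)) := by positivity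
      have h3 : r ^ 2 * (s n - 2 * r⁻¹ * s (n + 1) + r⁻¹ ^ 2 * s (n + 1 + 1)) =
          r * (r * s n) - 2 * r * s (n + 1) + s (n + 1 + 1) := by field_simp
      rw [h3] at h2
      nlinarith
  have hgrow : ∀ n, s 0 * r ^ n ≤ s n := by
    intro n
    induction n with
    | zero => simp
    | succ n ih =>
      calc s 0 * r ^ (n + 1) = r * (s 0 * r ^ n) := by ring
        _ ≤ r * s n := by gcongr
        _ ≤ _ := hstep n
  have hup : ∀ n, s n ≤ (‖A ^ n‖ * ‖H‖) ^ 2 := by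
    intro n
    have h1 : ∀ x, ‖(A ^ n) H x‖ ^ 2 ≤ (‖A ^ n‖ * ‖H‖) ^ 2 := fun x => by
      gcongr
      exact (ContinuousMap.norm_coe_le_norm _ x).trans ((A ^ n).le_opNorm H)
    calc s n ≤ ∫ _, (‖A ^ n‖ * ‖H‖) ^ 2 ∂μ :=
          integral_mono (Continuous.integrable_of_compactSpace μ (by fun_prop))
            (integrable_const _) h1
      _ = _ := by simp
  have hH' : 0 < ‖H‖ := norm_pos_iff.2 hH0
  obtain ⟨z, hz, hz0⟩ := exists_ne_zero_mem_spectrum_of_le_norm_pow A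
    (c := √(s 0) / ‖H‖) (r := √r) (by positivity) (by positivity) (fun n => by
      rw [div_mul_eq_mul_div, div_le_iff₀ hH']
      refine le_of_sq_le_sq ?_ (by positivity)
      rw [mul_pow, ← pow_mul, mul_comm n 2, pow_mul, Real.sq_sqrt hs0.le, Real.sq_sqrt hr0.le]
      exact (hgrow n).trans (hup n))
  exact ⟨z, hz0, ((isCompactOperator_convolveCLM μ H).hasEigenvalue_iff_mem_spectrum hz0).2 hz⟩

end Convolution

/-! ### Uniqueness of Fourier coefficients on compact abelian groups -/

section FourierUniqueness

/-- Regularity encloses a measurable `s` between a closed `C` and an open `U` with `U \ C` small. A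
Urysohn function for this pair differs from the indicator of `s` only on `U \ C`, where the integral
of `‖D‖` is small. -/
theorem ae_eq_zero_of_forall_integral_mul_eq_zero {K : Type*} [TopologicalSpace K]
    [CompactSpace K] [T2Space K] [MeasurableSpace K] [BorelSpace K] (μ : Measure K)
    [IsFiniteMeasure μ] [μ.Regular] {D : K → ℂ}
    (hD : Integrable D μ) (h : ∀ g : C(K, ℂ), ∫ x, D x * g x ∂μ = 0) : D =ᵐ[μ] 0 := by
  refine hD.ae_eq_zero_of_forall_setIntegral_eq_zero fun s hs _ => ?_
  rw [← norm_le_zero_iff]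
  refine le_of_forall_pos_le_add fun ε hε => ?_
  rw [zero_add]
  obtain ⟨δ, hδ, hsmall⟩ := exists_pos_setLIntegral_lt_of_measure_lt hD.2.ne
    (ENNReal.ofReal_pos.2 hε).ne'
  have hδ2 : δ / 2 ≠ 0 := (ENNReal.half_pos hδ.ne').ne'
  obtain ⟨C, hCs, hC, hsC⟩ := hs.exists_isClosed_sdiff_lt (measure_ne_top μ s) hδ2
  obtain ⟨U, hsU, hU, -, hUs⟩ := hs.exists_isOpen_sdiff_lt (measure_ne_top μ s) hδ2
  obtain ⟨g, hg0, hg1, hg⟩ := exists_continuous_zero_one_of_isClosed hU.isClosed_compl hC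
    (Set.disjoint_compl_left_iff_subset.2 (hCs.trans hsU))
  have hμ : μ (U \ C) < δ := by
    calc μ (U \ C) ≤ μ (U \ s ∪ s \ C) := measure_mono fun x hx => by
          by_cases hxs : x ∈ s
          · exact Or.inr ⟨hxs, hx.2⟩
          · exact Or.inl ⟨hx.1, hxs⟩
      _ ≤ μ (U \ s) + μ (s \ C) := measure_union_le _ _
      _ < δ / 2 + δ / 2 := ENNReal.add_lt_add hUs hsC
      _ = δ := ENNReal.add_halves δ
  have hgc := h ⟨fun x => (g x : ℂ), by fun_prop⟩
  simp only [ContinuousMap.coe_mk] at hgc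
  have hint : Integrable (fun x => D x * (g x : ℂ)) μ :=
    hD.mul_bdd (c := 1) (by fun_prop : Continuous fun x => (g x : ℂ)).measurable.aestronglyMeasurable
      (Eventually.of_forall fun x => by
        rw [Complex.norm_real, Real.norm_eq_abs, abs_of_nonneg (hg x).1]; exact (hg x).2)
  have hUC : MeasurableSet (U \ C) := hU.measurableSet.diff hC.measurableSet
  have hbound : ∀ x, ‖s.indicator D x - D x * (g x : ℂ)‖ ≤ (U \ C).indicator (fun x => ‖D x‖) x := by
    intro x
    by_cases hxC : x ∈ C
    · have h1 : g x = 1 := hg1 hxC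
      rw [Set.indicator_of_mem (hCs hxC), h1]
      simpa using Set.indicator_nonneg (fun _ _ => norm_nonneg _) x
    by_cases hxU : x ∈ U
    · rw [Set.indicator_of_mem (s := U \ C) ⟨hxU, hxC⟩]
      have h3 := hg x
      by_cases hxs : x ∈ s
      · rw [Set.indicator_of_mem hxs, show D x - D x * (g x : ℂ) = D x * ((1 - g x : ℝ) : ℂ) by
          push_cast; ring, norm_mul, Complex.norm_real, Real.norm_eq_abs,
          abs_of_nonneg (by linarith [h3.2])]
        exact mul_le_of_le_one_right (norm_nonneg _) (by linarith [h3.1])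
      · rw [Set.indicator_of_notMem hxs, zero_sub, norm_neg, norm_mul, Complex.norm_real,
          Real.norm_eq_abs, abs_of_nonneg h3.1]
        exact mul_le_of_le_one_right (norm_nonneg _) h3.2
    · have h1 : g x = 0 := hg0 hxU
      rw [Set.indicator_of_notMem (fun h => hxU (hsU h)), h1]
      simpa using Set.indicator_nonneg (fun _ _ => norm_nonneg _) x
  calc ‖∫ x in s, D x ∂μ‖ = ‖∫ x, (s.indicator D x - D x * (g x : ℂ)) ∂μ‖ := by
        rw [integral_sub (hD.indicator hs) hint, hgc, sub_zero, integral_indicator hs]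
    _ ≤ ∫ x, (U \ C).indicator (fun x => ‖D x‖) x ∂μ :=
        norm_integral_le_of_norm_le (hD.norm.indicator hUC) (Eventually.of_forall hbound)
    _ = ∫ x in U \ C, ‖D x‖ ∂μ := integral_indicator hUC
    _ ≤ ε := by
        rw [integral_norm_eq_lintegral_enorm hD.1.restrict]
        exact ENNReal.toReal_le_of_le_ofReal hε.le (hsmall _ hμ).le

variable {K : Type*} [CommGroup K] [TopologicalSpace K] [CompactSpace K]

/-- A continuous multiplicative function `K → ℂ` on a compact group, with value `1` at `1`, is a
character. -/
theorem exists_char_of_map_mul {w : C(K, ℂ)} (h1 : w 1 = 1)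
    (hmul : ∀ x y, w (x * y) = w x * w y) : ∃ χ : K →ₜ* Circle, ∀ x, (χ x : ℂ) = w x := by
  have hpow : ∀ x (n : ℕ), w (x ^ n) = w x ^ n := by
    intro x n
    induction n with
    | zero => simp [h1]
    | succ n ih => rw [pow_succ, hmul, ih, pow_succ]
  have hle : ∀ x, ‖w x‖ ≤ 1 := by
    intro x
    by_contra h
    push Not at h
    obtain ⟨n, hn⟩ := pow_unbounded_of_one_lt ‖w‖ h
    rw [← norm_pow, ← hpow] at hn
    exact absurd (w.norm_coe_le_norm _) hn.not_ge
  have hnorm : ∀ x, ‖w x‖ = 1 := by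
    intro x
    refine le_antisymm (hle x) ?_
    have h2 : ‖w x‖ * ‖w x⁻¹‖ = 1 := by rw [← norm_mul, ← hmul, mul_inv_cancel, h1, norm_one]
    nlinarith [hle x⁻¹, norm_nonneg (w x)]
  refine ⟨{ toFun := fun x => ⟨w x, mem_sphere_zero_iff_norm.2 (hnorm x)⟩
            map_one' := Subtype.ext h1
            map_mul' := fun x y => Subtype.ext (hmul x y)
            continuous_toFun := w.continuous.subtype_mk _ }, fun x => rfl⟩

variable [IsTopologicalGroup K] [MeasurableSpace K] [BorelSpace K] (μ : Measure K)
  [μ.IsHaarMeasure] [IsProbabilityMeasure μ] [μ.IsInvInvariant]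

/-- Translations commute with each other and with convolution by `H`, so they have a common
eigenvector `v` in a finite-dimensional eigenspace with eigenvalue `z ≠ 0`. Then `v / v 1` is a
character, and the eigenvalue equation at `1` says that the Fourier coefficient of `H` there is `z`.
-/
theorem exists_char_integral_ne_zero_of_hermitian {H : C(K, ℂ)}
    (hH : ∀ x, H x⁻¹ = (starRingEnd ℂ) (H x)) (hH0 : H ≠ 0) :
    ∃ χ : K →ₜ* Circle, ∫ x, H x * (starRingEnd ℂ) (χ x : ℂ) ∂μ ≠ 0 := by
  obtain ⟨z, hz0, hz⟩ := exists_hasEigenvalue_convolveCLM μ hH hH0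
  have := finiteDimensional_eigenspace_of_isCompactOperator (isCompactOperator_convolveCLM μ H) hz0
  let f : K → Module.End ℂ C(K, ℂ) := fun y =>
    { toFun := fun φ => translates φ y
      map_add' := fun φ ψ => by ext x; simp
      map_smul' := fun c φ => by ext x; simp }
  obtain ⟨v, hv, hv0, hvc⟩ := exists_common_eigenvector f
    (fun i j φ => by ext x; simp [f, mul_left_comm])
    (Module.End.eigenspace (convolveCLM μ H).toLinearMap z) hz (fun y φ hφ => by
      rw [Module.End.mem_eigenspace_iff] at hφ ⊢
      change convolveCLM μ H (translates φ y) = z • translates φ y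
      change convolveCLM μ H φ = z • φ at hφ
      rw [convolveCLM_translates, hφ]
      ext x; simp)
  choose c hc using hvc
  have hc' : ∀ y x, v (y⁻¹ * x) = c y * v x := fun y x => by
    have := DFunLike.congr_fun (hc y) x
    simpa [f] using this
  have hv1 : v 1 ≠ 0 := by
    intro h
    refine hv0 (ContinuousMap.ext fun x => ?_)
    have := hc' x⁻¹ 1
    simpa [h] using this
  have hinv : ∀ y x, v (y * x) = v y / v 1 * v x := by
    intro y x
    have h1 := hc' y⁻¹ 1
    have h2 := hc' y⁻¹ x
    rw [inv_inv, mul_one] at h1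
    rw [inv_inv] at h2
    rw [h2, h1, mul_div_cancel_right₀ _ hv1]
  obtain ⟨χ, hχ⟩ := exists_char_of_map_mul (w := (v 1)⁻¹ • v) (by simp [hv1]) (fun x y => by
    simp only [ContinuousMap.smul_apply, smul_eq_mul, hinv x y]
    field_simp)
  refine ⟨χ, ?_⟩
  have h3 : convolveCLM μ H v 1 = z * v 1 := by
    have : convolveCLM μ H v = z • v := Module.End.mem_eigenspace_iff.1 hv
    rw [this]; simp
  rw [convolveCLM_apply] at h3
  have h4 : ∀ x, (starRingEnd ℂ) (χ x : ℂ) = (v 1)⁻¹ * v (x⁻¹ * 1) := by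
    intro x
    rw [← Circle.coe_inv_eq_conj, ← map_inv, hχ, mul_one]
    simp
  have h5 : ∫ x, H x * (starRingEnd ℂ) (χ x : ℂ) ∂μ = z := by
    simp only [h4]
    calc _ = ∫ x, (v 1)⁻¹ * (H x * v (x⁻¹ * 1)) ∂μ := by congr 1; ext x; ring
      _ = z := by rw [integral_const_mul, h3]; field_simp
  rw [h5]
  exact hz0

/-- With `F' x = conj (F x⁻¹)`, both `F + F'` and `i (F - F')` are hermitian with vanishing
coefficients, hence zero. -/
theorem eq_zero_of_forall_char_integral_eq_zero {F : C(K, ℂ)}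
    (hF : ∀ χ : K →ₜ* Circle, ∫ x, F x * (starRingEnd ℂ) (χ x : ℂ) ∂μ = 0) : F = 0 := by
  have hF' : ∀ χ : K →ₜ* Circle,
      ∫ x, (starRingEnd ℂ) (F x⁻¹) * (starRingEnd ℂ) (χ x : ℂ) ∂μ = 0 := by
    intro χ
    rw [← integral_inv_eq_self]
    simp only [inv_inv, map_inv, Circle.coe_inv_eq_conj, ← map_mul]
    rw [integral_conj, hF χ, map_zero]
  have hint : ∀ (E : C(K, ℂ)) (χ : K →ₜ* Circle),
      Integrable (fun x => E x * (starRingEnd ℂ) (χ x : ℂ)) μ := fun E χ =>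
    Continuous.integrable_of_compactSpace μ (by fun_prop)
  let F' : C(K, ℂ) := ⟨fun x => (starRingEnd ℂ) (F x⁻¹), by fun_prop⟩
  have hF'a : ∀ x, F' x = (starRingEnd ℂ) (F x⁻¹) := fun x => rfl
  have hcomb : ∀ a b : ℂ, (∀ x, (a • F + b • F') x⁻¹ = (starRingEnd ℂ) ((a • F + b • F') x)) →
      a • F + b • F' = 0 := by
    intro a b hab
    by_contra h0
    obtain ⟨χ, hχ⟩ := exists_char_integral_ne_zero_of_hermitian μ hab h0
    refine hχ ?_
    simp only [ContinuousMap.add_apply, ContinuousMap.smul_apply, smul_eq_mul, add_mul, mul_assoc]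
    rw [integral_add ((hint F χ).const_mul a) ((hint F' χ).const_mul b), integral_const_mul,
      integral_const_mul, hF χ]
    simp only [hF'a]
    rw [hF' χ]
    simp
  have h1 := hcomb 1 1 fun x => by simp [hF'a, add_comm]
  have h2 := hcomb Complex.I (-Complex.I) fun x => by simp [hF'a, add_comm]
  ext x
  have h3 := DFunLike.congr_fun h1 x
  have h4 := DFunLike.congr_fun h2 x
  simp only [ContinuousMap.add_apply, ContinuousMap.smul_apply, smul_eq_mul, one_mul,
    ContinuousMap.zero_apply] at h3 h4 ⊢
  have h5 : Complex.I * (F x - F' x) = 0 := by rw [← h4]; ring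
  have h6 : F x - F' x = 0 := (mul_eq_zero.1 h5).resolve_left Complex.I_ne_zero
  linear_combination (h3 + h6) / 2

/-- An integrable function on a compact abelian group is determined by its Fourier transform. -/
theorem ae_eq_zero_of_forall_char_integral_eq_zero [T2Space K] [μ.Regular] {D : K → ℂ}
    (hD : Integrable D μ)
    (h : ∀ χ : K →ₜ* Circle, ∫ x, D x * (starRingEnd ℂ) (χ x : ℂ) ∂μ = 0) : D =ᵐ[μ] 0 := by
  refine ae_eq_zero_of_forall_integral_mul_eq_zero μ hD fun g => ?_
  let g' : C(K, ℂ) := ⟨fun x => g x⁻¹, by fun_prop⟩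
  -- The convolution is continuous and its coefficients are products of those of `D` and `g'`, hence
  -- zero. Its value at `1` is `∫ D * g`.
  have h0 : convolve μ D g' = 0 := by
    refine eq_zero_of_forall_char_integral_eq_zero μ fun χ => ?_
    let L : C(K, ℂ) →L[ℂ] ℂ := LinearMap.mkContinuous
      { toFun := fun φ => ∫ x, φ x * (starRingEnd ℂ) (χ x : ℂ) ∂μ
        map_add' := fun φ ψ => by
          simp only [ContinuousMap.add_apply, add_mul]
          exact integral_add (Continuous.integrable_of_compactSpace μ (by fun_prop))
            (Continuous.integrable_of_compactSpace μ (by fun_prop))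
        map_smul' := fun c φ => by
          simp only [ContinuousMap.smul_apply, smul_eq_mul, mul_assoc, RingHom.id_apply]
          exact integral_const_mul _ _ } 1 (fun φ => by
        refine (norm_integral_le_of_norm_le_const (C := ‖φ‖)
          (Eventually.of_forall fun x => ?_)).trans (by simp)
        rw [norm_mul, RCLike.norm_conj, Circle.norm_coe, mul_one]
        exact φ.norm_coe_le_norm x)
    have hL : ∀ φ, L φ = ∫ x, φ x * (starRingEnd ℂ) (χ x : ℂ) ∂μ := fun φ => rfl
    have hLt : ∀ φ z, L (translates φ z) = (starRingEnd ℂ) (χ z : ℂ) * L φ := by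
      intro φ z
      rw [hL, hL, ← integral_const_mul, ← integral_mul_left_eq_self _ z]
      congr 1
      ext x
      simp only [translates_apply, inv_mul_cancel_left, map_mul, Circle.coe_mul]
      ring
    rw [← hL, map_convolve μ hD]
    simp only [hLt, ← mul_assoc]
    rw [integral_mul_const, h χ, zero_mul]
  have h1 := DFunLike.congr_fun h0 1
  rw [convolve_apply μ hD] at h1
  simpa [g'] using h1

end FourierUniqueness

/-! ### Kernels for the spectral cut-offs -/

section Kernel

open scoped FourierTransform

/-- The even trapezoid function that is `1` on `[-A, A]` and `0` off `[-B, B]`. -/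
noncomputable def trapezoid (A B x : ℝ) : ℝ := max 0 (min 1 ((B - |x|) / (B - A)))

theorem continuous_trapezoid (A B : ℝ) : Continuous (trapezoid A B) := by
  unfold trapezoid
  fun_prop

theorem trapezoid_abs (A B x : ℝ) : trapezoid A B |x| = trapezoid A B x := by
  simp [trapezoid]

theorem trapezoid_of_abs_le {A B x : ℝ} (hAB : A < B) (hx : |x| ≤ A) : trapezoid A B x = 1 := by
  have h : 1 ≤ (B - |x|) / (B - A) := by rw [one_le_div (by linarith)]; linarith
  rw [trapezoid, min_eq_left h, max_eq_right zero_le_one]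

theorem trapezoid_of_le_abs {A B x : ℝ} (hAB : A < B) (hx : B ≤ |x|) : trapezoid A B x = 0 := by
  have h : (B - |x|) / (B - A) ≤ 0 := div_nonpos_of_nonpos_of_nonneg (by linarith) (by linarith)
  rw [trapezoid, max_eq_left ((min_le_right _ _).trans h)]

theorem trapezoid_of_mem_Icc {A B x : ℝ} (hA : 0 ≤ A) (hAB : A < B) (hx : x ∈ Set.Icc A B) :
    trapezoid A B x = (B - x) / (B - A) := by
  have h1 : (B - x) / (B - A) ≤ 1 := by rw [div_le_one (by linarith)]; linarith [hx.1]
  have h2 : 0 ≤ (B - x) / (B - A) := div_nonneg (by linarith [hx.2]) (by linarith)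
  rw [trapezoid, abs_of_nonneg (hA.trans hx.1), min_eq_right h1, max_eq_right h2]

theorem abs_trapezoid_le_one (A B x : ℝ) : |trapezoid A B x| ≤ 1 := by
  rw [trapezoid, abs_of_nonneg (le_max_left _ _)]
  exact max_le zero_le_one (min_le_left _ _)

theorem hasCompactSupport_trapezoid {A B : ℝ} (hAB : A < B) :
    HasCompactSupport (trapezoid A B) := by
  refine HasCompactSupport.intro (isCompact_Icc (a := -B) (b := B)) fun x hx =>
    trapezoid_of_le_abs hAB ?_
  by_contra h
  push Not at h
  exact hx ⟨(abs_lt.1 h).1.le, (abs_lt.1 h).2.le⟩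

theorem fourier_trapezoid {A B : ℝ} (hA : 0 ≤ A) (hAB : A < B) (ξ : ℝ) :
    𝓕 (fun x => (trapezoid A B x : ℂ)) ξ =
      ((2 * ∫ x in (0 : ℝ)..B, trapezoid A B x * Real.cos (2 * Real.pi * ξ * x) : ℝ) : ℂ) := by
  set e : ℝ → ℂ := fun x => Complex.exp (↑(-2 * Real.pi * x * ξ) * Complex.I) *
    (trapezoid A B x : ℂ) with he
  have hs : HasCompactSupport e := by
    refine HasCompactSupport.mul_left ?_
    exact (hasCompactSupport_trapezoid hAB).comp_left (g := fun r : ℝ => (r : ℂ)) rfl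
  have hc : Continuous e := by
    have := continuous_trapezoid A B
    fun_prop
  have hint : Integrable e := hc.integrable_of_hasCompactSupport hs
  have h1 : 𝓕 (fun x => (trapezoid A B x : ℂ)) ξ = ∫ x, e x := by
    rw [Real.fourier_real_eq_integral_exp_smul]
    simp [he]
  have h2 : (∫ x, e x) = ∫ x, ((trapezoid A B x * Real.cos (2 * Real.pi * ξ * x) : ℝ) : ℂ) := by
    have h3 : ∀ x, ((trapezoid A B x * Real.cos (2 * Real.pi * ξ * x) : ℝ) : ℂ) =
        (e x + e (-x)) / 2 := by
      intro x
      have h4 : trapezoid A B (-x) = trapezoid A B x := by rw [← trapezoid_abs, abs_neg, trapezoid_abs]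
      simp only [he, h4]
      push_cast
      rw [Complex.cos]
      ring_nf
    simp only [h3]
    rw [integral_div, integral_add hint hint.comp_neg, integral_neg_eq_self]
    ring
  rw [h1, h2, integral_complex_ofReal]
  congr 1
  have h5 : ∀ x, trapezoid A B x * Real.cos (2 * Real.pi * ξ * x) =
      (fun y => trapezoid A B y * Real.cos (2 * Real.pi * ξ * y)) |x| := by
    intro x
    simp only [trapezoid_abs]
    rcases abs_choice x with h | h <;> rw [h]
    rw [mul_neg, Real.cos_neg]
  calc _ = ∫ x, (fun y => trapezoid A B y * Real.cos (2 * Real.pi * ξ * y)) |x| := by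
        simp only [← h5]
    _ = _ := by
      rw [integral_comp_abs
          (f := fun y => trapezoid A B y * Real.cos (2 * Real.pi * ξ * y)),
        intervalIntegral.integral_of_le (hA.trans hAB.le),
        setIntegral_eq_of_subset_of_forall_sdiff_eq_zero measurableSet_Ioi
          (Set.Ioc_subset_Ioi_self : Set.Ioc 0 B ⊆ Set.Ioi 0) fun x hx => ?_]
      have hxB : B ≤ |x| := by
        rw [abs_of_pos hx.1]
        by_contra h
        exact hx.2 ⟨hx.1, by linarith⟩
      rw [trapezoid_of_le_abs hAB hxB, zero_mul]

theorem integral_trapezoid_mul_cos {A B w : ℝ} (hA : 0 ≤ A) (hAB : A < B) (hw : w ≠ 0) :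
    ∫ x in (0 : ℝ)..B, trapezoid A B x * Real.cos (w * x) =
      (Real.cos (w * A) - Real.cos (w * B)) / ((B - A) * w ^ 2) := by
  have hδ : B - A ≠ 0 := by linarith
  have hci : ∀ a b, IntervalIntegrable (fun x => trapezoid A B x * Real.cos (w * x)) volume a b :=
    fun a b => Continuous.intervalIntegrable (by
      have := continuous_trapezoid A B
      fun_prop) _ _
  rw [← intervalIntegral.integral_add_adjacent_intervals (hci 0 A) (hci A B)]
  have h1 : ∫ x in (0 : ℝ)..A, trapezoid A B x * Real.cos (w * x) = Real.sin (w * A) / w := by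
    rw [intervalIntegral.integral_congr (g := fun x => Real.cos (w * x)) fun x hx => ?_]
    · rw [intervalIntegral.integral_eq_sub_of_hasDerivAt
        (f := fun x => Real.sin (w * x) / w) (fun x _ => ?_)
        (Continuous.intervalIntegrable (by fun_prop) _ _)]
      · simp
      · have := (((hasDerivAt_id x).const_mul w).sin).div_const w
        simpa [hw] using this
    · rw [Set.uIcc_of_le hA] at hx
      simp only
      rw [trapezoid_of_abs_le hAB (by rw [abs_of_nonneg hx.1]; exact hx.2), one_mul]
  have h2 : ∫ x in A..B, trapezoid A B x * Real.cos (w * x) =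
      (Real.cos (w * A) - Real.cos (w * B)) / ((B - A) * w ^ 2) - Real.sin (w * A) / w := by
    rw [intervalIntegral.integral_congr
      (g := fun x => (B - x) / (B - A) * Real.cos (w * x)) fun x hx => ?_]
    · rw [intervalIntegral.integral_eq_sub_of_hasDerivAt
        (f := fun x => (B - x) / (B - A) * (Real.sin (w * x) / w) -
          Real.cos (w * x) / ((B - A) * w ^ 2)) (fun x _ => ?_)
        (Continuous.intervalIntegrable (by fun_prop) _ _)]
      · simp only [sub_self, zero_div, zero_mul, zero_sub, div_self hδ, one_mul]
        ring
      · have h3 := (((hasDerivAt_id x).const_sub B).div_const (B - A)).mul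
          ((((hasDerivAt_id x).const_mul w).sin).div_const w)
        have h4 := (((hasDerivAt_id x).const_mul w).cos).div_const ((B - A) * w ^ 2)
        refine (h3.sub h4).congr_deriv ?_
        simp only [id]
        field_simp
        ring
    · rw [Set.uIcc_of_le hAB.le] at hx
      simp only
      rw [trapezoid_of_mem_Icc hA hAB hx]
  rw [h1, h2]
  ring

theorem norm_fourier_trapezoid_le {A B : ℝ} (hA : 0 ≤ A) (hAB : A < B) (ξ : ℝ) :
    ‖𝓕 (fun x => (trapezoid A B x : ℂ)) ξ‖ ≤ 2 * B := by
  rw [fourier_trapezoid hA hAB, Complex.norm_real, norm_mul, Real.norm_ofNat]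
  gcongr
  have := intervalIntegral.norm_integral_le_of_norm_le_const (a := 0) (b := B)
    (f := fun x => trapezoid A B x * Real.cos (2 * Real.pi * ξ * x)) (C := 1) fun x _ => by
      rw [norm_mul]
      exact mul_le_one₀ (abs_trapezoid_le_one A B x) (norm_nonneg _) (Real.abs_cos_le_one _)
  rwa [one_mul, sub_zero, abs_of_nonneg (hA.trans hAB.le)] at this

/-- The difference of cosines is at most `2` and at most `2π (B - A) |ξ|`. Interpolating with
weights `θ` and `1 - θ` keeps decay integrable at infinity for `θ > 0`, at the cost of only `(B - A)
^ (-θ)`. -/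
theorem norm_fourier_trapezoid_le_rpow {A B θ ξ : ℝ} (hA : 0 ≤ A) (hAB : A < B) (hθ0 : 0 ≤ θ)
    (hθ : θ ≤ 1) (hξ : ξ ≠ 0) :
    ‖𝓕 (fun x => (trapezoid A B x : ℂ)) ξ‖ ≤ (B - A) ^ (-θ) * |ξ| ^ (-(1 + θ)) := by
  have hδ : 0 < B - A := by linarith
  have hξ' : 0 < |ξ| := abs_pos.2 hξ
  have hpi := Real.pi_pos
  rw [fourier_trapezoid hA hAB, integral_trapezoid_mul_cos hA hAB (by positivity),
    Complex.norm_real, norm_mul, Real.norm_ofNat, norm_div, Real.norm_eq_abs, Real.norm_eq_abs,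
    abs_of_pos (by positivity : 0 < (B - A) * (2 * Real.pi * ξ) ^ 2)]
  set D := |Real.cos (2 * Real.pi * ξ * A) - Real.cos (2 * Real.pi * ξ * B)| with hD
  have hD0 : 0 ≤ D := abs_nonneg _
  have hD2 : D ≤ 2 := by
    have h1 := Real.abs_cos_le_one (2 * Real.pi * ξ * A)
    have h2 := Real.abs_cos_le_one (2 * Real.pi * ξ * B)
    exact (abs_sub _ _).trans (by linarith)
  have hDl : D ≤ 2 * Real.pi * ((B - A) * |ξ|) := by
    refine (Real.abs_cos_sub_cos_le _ _).trans_eq ?_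
    rw [← mul_sub, abs_mul, abs_mul, abs_of_pos (by positivity : 0 < 2 * Real.pi),
      abs_sub_comm, abs_of_pos hδ]
    ring
  have hDθ : D ≤ 2 * (2 * Real.pi) * ((B - A) * |ξ|) ^ (1 - θ) := by
    calc D = D ^ θ * D ^ (1 - θ) := by
          rw [← Real.rpow_add_of_nonneg hD0 hθ0 (by linarith)]; simp
      _ ≤ 2 ^ θ * (2 * Real.pi * ((B - A) * |ξ|)) ^ (1 - θ) := by
          gcongr
      _ = 2 ^ θ * (2 * Real.pi) ^ (1 - θ) * ((B - A) * |ξ|) ^ (1 - θ) := by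
          rw [Real.mul_rpow (by positivity) (by positivity), mul_assoc]
      _ ≤ _ := by
          gcongr
          · calc (2 : ℝ) ^ θ ≤ 2 ^ (1 : ℝ) := Real.rpow_le_rpow_of_exponent_le (by norm_num) hθ
              _ = 2 := Real.rpow_one 2
          · calc (2 * Real.pi) ^ (1 - θ) ≤ (2 * Real.pi) ^ (1 : ℝ) :=
                Real.rpow_le_rpow_of_exponent_le (by linarith [Real.pi_gt_three]) (by linarith)
              _ = _ := Real.rpow_one _
  calc 2 * (D / ((B - A) * (2 * Real.pi * ξ) ^ 2))
      ≤ 2 * (2 * (2 * Real.pi) * ((B - A) * |ξ|) ^ (1 - θ) / ((B - A) * (2 * Real.pi * ξ) ^ 2)) := by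
        gcongr
    _ = 2 / Real.pi * ((B - A) ^ (-θ) * |ξ| ^ (-(1 + θ))) := by
        rw [Real.mul_rpow hδ.le hξ'.le, mul_pow, ← sq_abs ξ,
          show (B - A) ^ (1 - θ) = (B - A) ^ (-θ) * (B - A) by
            rw [← Real.rpow_add_one hδ.ne']; congr 1; ring,
          show |ξ| ^ (1 - θ) = |ξ| ^ (-(1 + θ)) * |ξ| ^ 2 by
            rw [← Real.rpow_natCast, ← Real.rpow_add hξ']; congr 1; push_cast; ring]
        field_simp
    _ ≤ 1 * ((B - A) ^ (-θ) * |ξ| ^ (-(1 + θ))) := by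
        gcongr
        rw [div_le_one hpi]
        linarith [Real.pi_gt_three]
    _ = _ := one_mul _

theorem continuous_fourier_trapezoid {A B : ℝ} (hAB : A < B) :
    Continuous (𝓕 (fun x => (trapezoid A B x : ℂ))) := by
  have hint : Integrable (fun x => (trapezoid A B x : ℂ)) :=
    ((continuous_trapezoid A B).integrable_of_hasCompactSupport
      (hasCompactSupport_trapezoid hAB)).ofReal
  exact VectorFourier.fourierIntegral_continuous Real.continuous_fourierChar
    (by exact continuous_inner) hint

theorem integral_fourier_trapezoid_mul_exp {A B : ℝ} (hAB : A < B)
    (hint : Integrable (𝓕 (fun x => (trapezoid A B x : ℂ)))) (x : ℝ) :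
    ∫ ξ, 𝓕 (fun x => (trapezoid A B x : ℂ)) ξ * Complex.exp (↑(2 * Real.pi * ξ * x) * Complex.I) =
      trapezoid A B x := by
  have hc : Continuous (fun x => (trapezoid A B x : ℂ)) :=
    Complex.continuous_ofReal.comp (continuous_trapezoid A B)
  have h := congrFun (hc.fourierInv_fourier_eq ((continuous_trapezoid A B).integrable_of_hasCompactSupport
      (hasCompactSupport_trapezoid hAB)).ofReal hint) x
  rw [Real.fourierInv_eq'] at h
  rw [← h]
  congr 1
  ext ξ
  simp only [smul_eq_mul, RCLike.inner_apply, conj_trivial]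
  rw [mul_comm, mul_comm x ξ, mul_assoc]

/-- Under Bohr's condition, for every `u > 0` the spectral cut-offs at `λₙ` are given by kernels
`k n` such that all `e^{-uλₙ} |k n|` have a common integrable bound. -/
theorem BohrCondition.exists_kernel {lam : ℕ → ℝ} (hBC : BohrCondition lam)
    (hlam : IsFrequency lam) {u : ℝ} (hu : 0 < u) :
    ∃ (k : ℕ → ℝ → ℂ) (g : ℝ → ℝ), Continuous g ∧ Integrable g ∧ (∀ ξ, 0 ≤ g ξ) ∧
      (∀ n, Continuous (k n)) ∧ (∀ n, Integrable (k n)) ∧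
      (∀ n ξ, Real.exp (-(u * lam n)) * ‖k n ξ‖ ≤ g ξ) ∧
      ∀ n m, ∫ ξ, k n ξ * Complex.exp (↑(2 * Real.pi * ξ * lam m) * Complex.I) =
        if m ≤ n then 1 else 0 := by
  obtain ⟨l, hl, hBC⟩ := hBC
  obtain ⟨c, hc, hBC⟩ := hBC 1 one_pos
  set c₀ := min c 1 with hc₀
  have hc₀0 : 0 < c₀ := lt_min hc one_pos
  -- Chosen so that `θ * (l + 1) ≤ u`: the loss `(B n - lam n) ^ (-θ)` is then absorbed by
  -- `e^{-uλₙ}`.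
  set θ := min 1 (u / (l + 1)) with hθ
  have hl1 : 0 < l + 1 := by linarith
  have hθ0 : 0 < θ := lt_min one_pos (by positivity)
  have hθ1 : θ ≤ 1 := min_le_left _ _
  have hθu : θ * (l + 1) ≤ u := by
    calc θ * (l + 1) ≤ u / (l + 1) * (l + 1) := by gcongr; exact min_le_right _ _
      _ = u := by field_simp
  -- The bound `lam (n + 1)` makes the cut-off kill all later frequencies. The bound `lam n + 1`
  -- keeps the estimate `2 * B n` near `ξ = 0` under control when the gap is large.
  set B : ℕ → ℝ := fun n => min (lam (n + 1)) (lam n + 1) with hB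
  have hAB : ∀ n, lam n < B n := fun n => lt_min (hlam.strictMono n.lt_succ_self) (by linarith)
  have hB1 : ∀ n, B n ≤ lam n + 1 := fun n => min_le_right _ _
  have hδ : ∀ n, c₀ * Real.exp (-((l + 1) * lam n)) ≤ B n - lam n := by
    intro n
    rw [le_sub_iff_add_le]
    refine le_min ?_ ?_
    · have h1 := hBC n
      have h2 : c₀ * Real.exp (-((l + 1) * lam n)) ≤ c * Real.exp (-(l + 1) * lam n) := by
        rw [neg_mul]
        gcongr
        exact min_le_left _ _
      linarith
    · have h2 : c₀ * Real.exp (-((l + 1) * lam n)) ≤ 1 * 1 := by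
        refine mul_le_mul (min_le_right _ _) (Real.exp_le_one_iff.2 ?_) (Real.exp_nonneg _) zero_le_one
        have := hlam.nonneg n
        have : 0 ≤ (l + 1) * lam n := by positivity
        linarith
      linarith
  -- The terms `2 + 2 / u` serve `|ξ| ≤ 1`, and `c₀ ^ (-θ)` serves `|ξ| > 1`.
  set M := 2 + 2 / u + c₀ ^ (-θ) with hM
  have hM0 : 0 ≤ M := by positivity
  set g : ℝ → ℝ := fun ξ => 4 * M * (1 + ‖ξ‖) ^ (-(1 + θ)) with hg
  have hgint : Integrable g := by
    refine (integrable_one_add_norm (r := 1 + θ) ?_).const_mul _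
    simp [hθ0]
  have hgc : Continuous g := by
    refine continuous_const.mul (Continuous.rpow_const (by fun_prop) fun ξ => Or.inl ?_)
    positivity
  have hbound : ∀ n ξ, Real.exp (-(u * lam n)) * ‖𝓕 (fun x => (trapezoid (lam n) (B n) x : ℂ)) ξ‖ ≤
      g ξ := by
    intro n ξ
    have hA := hlam.nonneg n
    have h4 : ∀ y : ℝ, 0 < y → (1 + ‖ξ‖) ≤ 2 * y → y ^ (-(1 + θ)) ≤ 4 * (1 + ‖ξ‖) ^ (-(1 + θ)) := by
      intro y hy hy2
      have h5 : (2 * y) ^ (-(1 + θ)) ≤ (1 + ‖ξ‖) ^ (-(1 + θ)) :=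
        Real.rpow_le_rpow_of_nonpos (by positivity) hy2 (by linarith)
      rw [Real.mul_rpow (by norm_num) hy.le] at h5
      have h6 : (1 : ℝ) / 4 ≤ 2 ^ (-(1 + θ)) := by
        calc (1 : ℝ) / 4 = 2 ^ (-2 : ℝ) := by
              rw [Real.rpow_neg (by norm_num)]; norm_num
          _ ≤ _ := Real.rpow_le_rpow_of_exponent_le (by norm_num) (by linarith)
      have h7 : 0 ≤ y ^ (-(1 + θ)) := by positivity
      nlinarith
    rcases le_or_gt |ξ| 1 with hξ | hξ
    · have h1 := norm_fourier_trapezoid_le hA (hAB n) ξ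
      have h2 := h4 1 one_pos (by rw [Real.norm_eq_abs]; linarith)
      rw [Real.one_rpow] at h2
      have h3 : lam n * Real.exp (-(u * lam n)) ≤ 1 / u := by
        rw [Real.exp_neg, ← div_eq_mul_inv, div_le_div_iff₀ (Real.exp_pos _) hu]
        linarith [Real.add_one_le_exp (u * lam n)]
      have h5 : Real.exp (-(u * lam n)) ≤ 1 := Real.exp_le_one_iff.2 (by
        have : 0 ≤ u * lam n := by positivity
        linarith)
      calc _ ≤ Real.exp (-(u * lam n)) * (2 * (lam n + 1)) := by
            gcongr; exact h1.trans (by linarith [hB1 n])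
        _ = 2 * (lam n * Real.exp (-(u * lam n))) + 2 * Real.exp (-(u * lam n)) := by ring
        _ ≤ 2 * (1 / u) + 2 * 1 := by gcongr
        _ ≤ M * 1 := by
            have : 0 ≤ c₀ ^ (-θ) := by positivity
            rw [hM]
            have : 2 * (1 / u) = 2 / u := by ring
            linarith
        _ ≤ M * (4 * (1 + ‖ξ‖) ^ (-(1 + θ))) := by gcongr
        _ = g ξ := by rw [hg]; ring
    · have hξ0 : ξ ≠ 0 := by rintro rfl; simp at hξ; linarith
      have h1 := norm_fourier_trapezoid_le_rpow hA (hAB n) hθ0.le hθ1 hξ0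
      have h2 := h4 |ξ| (by linarith) (by rw [Real.norm_eq_abs]; linarith)
      have h3 : (B n - lam n) ^ (-θ) ≤ c₀ ^ (-θ) * Real.exp (u * lam n) := by
        calc (B n - lam n) ^ (-θ) ≤ (c₀ * Real.exp (-((l + 1) * lam n))) ^ (-θ) :=
              Real.rpow_le_rpow_of_nonpos (by positivity) (hδ n) (by linarith)
          _ = c₀ ^ (-θ) * Real.exp (θ * (l + 1) * lam n) := by
              rw [Real.mul_rpow hc₀0.le (Real.exp_nonneg _), ← Real.exp_mul]
              congr 2
              ring
          _ ≤ _ := by gcongr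
      calc _ ≤ Real.exp (-(u * lam n)) * ((c₀ ^ (-θ) * Real.exp (u * lam n)) *
              (4 * (1 + ‖ξ‖) ^ (-(1 + θ)))) := by
            gcongr
            exact h1.trans (by gcongr)
        _ = (Real.exp (-(u * lam n)) * Real.exp (u * lam n)) * c₀ ^ (-θ) *
              (4 * (1 + ‖ξ‖) ^ (-(1 + θ))) := by ring
        _ ≤ M * (4 * (1 + ‖ξ‖) ^ (-(1 + θ))) := by
            rw [← Real.exp_add, neg_add_cancel, Real.exp_zero, one_mul]
            gcongr
            have : 0 ≤ 2 / u := by positivity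
            rw [hM]
            linarith
        _ = g ξ := by rw [hg]; ring
  have hint : ∀ n, Integrable (𝓕 (fun x => (trapezoid (lam n) (B n) x : ℂ))) := by
    intro n
    refine (hgint.const_mul (Real.exp (u * lam n))).mono'
      (continuous_fourier_trapezoid (hAB n)).aestronglyMeasurable (Eventually.of_forall fun ξ => ?_)
    calc _ = Real.exp (u * lam n) * (Real.exp (-(u * lam n)) *
          ‖𝓕 (fun x => (trapezoid (lam n) (B n) x : ℂ)) ξ‖) := by
          rw [← mul_assoc, ← Real.exp_add, add_neg_cancel, Real.exp_zero, one_mul]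
      _ ≤ _ := by gcongr; exact hbound n ξ
  refine ⟨fun n => 𝓕 (fun x => (trapezoid (lam n) (B n) x : ℂ)), g, hgc, hgint,
    fun ξ => by positivity, fun n => continuous_fourier_trapezoid (hAB n), hint, hbound,
    fun n m => ?_⟩
  rw [integral_fourier_trapezoid_mul_exp (hAB n) (hint n)]
  split_ifs with hmn
  · rw [trapezoid_of_abs_le (hAB n) (by
      rw [abs_of_nonneg (hlam.nonneg m)]; exact hlam.strictMono.monotone hmn)]
    simp
  · rw [trapezoid_of_le_abs (hAB n) (by
      rw [abs_of_nonneg (hlam.nonneg m)]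
      exact (min_le_left _ _).trans (hlam.strictMono.monotone (by omega)))]
    simp

end Kernel

/-! ### Abel summation -/

section Abel

/-- With `x n = e^{-vλₙ}`, only `x N * ‖S N‖` is controlled, so the weights in the sum are squares:
`x N ^ 2 - x (N + 1) ^ 2 ≤ 2 * x N * (x N - x (N + 1))`, and the differences telescope with no
condition on the gaps of `lam`. -/
theorem norm_sum_mul_exp_le {c : ℕ → ℂ} {lam : ℕ → ℝ} (hmono : Monotone lam)
    (hnonneg : ∀ n, 0 ≤ lam n) {v Q : ℝ} (hv : 0 < v) (hQ : 0 ≤ Q)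
    (h : ∀ N, Real.exp (-(v * lam N)) * ‖∑ n ∈ Finset.range (N + 1), c n‖ ≤ Q) (N : ℕ) :
    ‖∑ n ∈ Finset.range (N + 1), c n * (Real.exp (-(v * lam n)) ^ 2 : ℝ)‖ ≤ 2 * Q := by
  set x : ℕ → ℝ := fun n => Real.exp (-(v * lam n)) with hx
  have hx0 : ∀ n, 0 < x n := fun n => Real.exp_pos _
  have hx1 : ∀ n, x n ≤ 1 := fun n => Real.exp_le_one_iff.2 (by
    have := hnonneg n
    have : 0 ≤ v * lam n := by positivity
    linarith)
  have hanti : ∀ n, x (n + 1) ≤ x n := fun n => Real.exp_le_exp.2 (by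
    have := hmono n.le_succ
    have : v * lam n ≤ v * lam (n + 1) := by gcongr
    linarith)
  set S : ℕ → ℂ := fun N => ∑ n ∈ Finset.range (N + 1), c n with hS
  set T : ℕ → ℂ := fun N => ∑ n ∈ Finset.range (N + 1), c n * (x n ^ 2 : ℝ) with hT
  have key : ∀ N, ‖T N - S N * (x N ^ 2 : ℝ)‖ ≤ 2 * Q * (1 - x N) := by
    intro N
    induction N with
    | zero =>
      have : 0 ≤ 2 * Q * (1 - x 0) := mul_nonneg (by positivity) (by linarith [hx1 0])
      simpa [hT, hS] using this
    | succ N ih =>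
      have h1 : T (N + 1) - S (N + 1) * (x (N + 1) ^ 2 : ℝ) =
          (T N - S N * (x N ^ 2 : ℝ)) + S N * ((x N ^ 2 - x (N + 1) ^ 2 : ℝ) : ℂ) := by
        simp only [hT, hS]
        rw [Finset.sum_range_succ _ (N + 1), Finset.sum_range_succ c (N + 1)]
        push_cast
        ring
      have h2 : ‖S N * ((x N ^ 2 - x (N + 1) ^ 2 : ℝ) : ℂ)‖ ≤ 2 * Q * (x N - x (N + 1)) := by
        have h3 : 0 ≤ x N - x (N + 1) := by linarith [hanti N]
        rw [norm_mul, Complex.norm_real, Real.norm_eq_abs,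
          abs_of_nonneg (by nlinarith [hanti N, (hx0 (N + 1)).le])]
        calc ‖S N‖ * (x N ^ 2 - x (N + 1) ^ 2)
            = (‖S N‖ * (x N + x (N + 1))) * (x N - x (N + 1)) := by ring
          _ ≤ (‖S N‖ * (2 * x N)) * (x N - x (N + 1)) := by
              gcongr; linarith [hanti N]
          _ = 2 * (x N * ‖S N‖) * (x N - x (N + 1)) := by ring
          _ ≤ 2 * Q * (x N - x (N + 1)) := by gcongr; exact h N
      rw [h1]
      calc _ ≤ 2 * Q * (1 - x N) + 2 * Q * (x N - x (N + 1)) := (norm_add_le _ _).trans (by gcongr)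
        _ = _ := by ring
  have h4 : ‖S N * (x N ^ 2 : ℝ)‖ ≤ Q * x N := by
    rw [norm_mul, Complex.norm_real, Real.norm_eq_abs, abs_of_nonneg (by positivity)]
    calc _ = (x N * ‖S N‖) * x N := by ring
      _ ≤ _ := by gcongr; exact h N
  calc ‖T N‖ = ‖(T N - S N * (x N ^ 2 : ℝ)) + S N * (x N ^ 2 : ℝ)‖ := by congr 1; ring
    _ ≤ 2 * Q * (1 - x N) + Q * x N := (norm_add_le _ _).trans (add_le_add (key N) h4)
    _ ≤ 2 * Q := by nlinarith [hx0 N]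

end Abel

/-! ### Orthogonality of characters -/

section Orthogonality

variable {K : Type*} [CommGroup K] [TopologicalSpace K] [MeasurableSpace K] (μ : Measure K)

theorem integral_char_mul_conj_char_self [IsProbabilityMeasure μ] (χ : K →ₜ* Circle) :
    ∫ ω, (χ ω : ℂ) * (starRingEnd ℂ) (χ ω : ℂ) ∂μ = 1 := by
  have : ∀ ω, (χ ω : ℂ) * (starRingEnd ℂ) (χ ω : ℂ) = 1 := fun ω => by
    rw [← Circle.coe_inv_eq_conj, ← Circle.coe_mul, mul_inv_cancel, Circle.coe_one]
  simp [this]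

theorem integral_char_mul_conj_char_of_ne [IsTopologicalGroup K] [BorelSpace K]
    [μ.IsMulLeftInvariant] {χ ψ : K →ₜ* Circle} (h : χ ≠ ψ) :
    ∫ ω, (χ ω : ℂ) * (starRingEnd ℂ) (ψ ω : ℂ) ∂μ = 0 := by
  obtain ⟨y, hy⟩ : ∃ y, χ y ≠ ψ y := by
    by_contra hc
    push Not at hc
    exact h (DFunLike.ext _ _ hc)
  have h1 := integral_mul_left_eq_self (μ := μ)
    (fun ω => (χ ω : ℂ) * (starRingEnd ℂ) (ψ ω : ℂ)) y
  have h2 : ∀ ω, (χ (y * ω) : ℂ) * (starRingEnd ℂ) (ψ (y * ω) : ℂ) =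
      ((χ y : ℂ) * (starRingEnd ℂ) (ψ y : ℂ)) * ((χ ω : ℂ) * (starRingEnd ℂ) (ψ ω : ℂ)) := by
    intro ω
    simp only [map_mul, Circle.coe_mul]
    ring
  simp only [h2] at h1
  rw [integral_const_mul] at h1
  have h3 : (χ y : ℂ) * (starRingEnd ℂ) (ψ y : ℂ) ≠ 1 := by
    rw [← Circle.coe_inv_eq_conj, ← Circle.coe_mul, ← div_eq_mul_inv, ne_eq, Circle.coe_eq_one,
      div_eq_one]
    exact hy
  have h4 : ((χ y : ℂ) * (starRingEnd ℂ) (ψ y : ℂ) - 1) *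
      ∫ ω, (χ ω : ℂ) * (starRingEnd ℂ) (ψ ω : ℂ) ∂μ = 0 := by rw [sub_mul, h1]; ring
  exact (mul_eq_zero.1 h4).resolve_left (sub_ne_zero.2 h3)

end Orthogonality

/-! ### Averages along the flow -/

section FlowConvolution

variable {K : Type*} [CommGroup K] [TopologicalSpace K] [IsTopologicalGroup K]
  [MeasurableSpace K] [BorelSpace K] (μ : Measure K)
  [IsProbabilityMeasure μ] [μ.IsMulLeftInvariant]

theorem integrable_prod_mul_flow {f : K → ℂ} (hf : StronglyMeasurable f) (hfi : Integrable f μ)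
    {b : ℝ → K} (hb : Continuous b) {k : ℝ → ℂ} (hk : Continuous k) (hki : Integrable k) :
    Integrable (fun p : K × ℝ => k p.2 * f (p.1 * b p.2)) (μ.prod volume) := by
  have hm : AEStronglyMeasurable (fun p : K × ℝ => k p.2 * f (p.1 * b p.2)) (μ.prod volume) := by
    refine StronglyMeasurable.aestronglyMeasurable ?_
    exact (hk.stronglyMeasurable.comp_measurable measurable_snd).mul
      (hf.comp_measurable (by fun_prop : Continuous fun p : K × ℝ => p.1 * b p.2).measurable)
  rw [integrable_prod_iff' hm]
  refine ⟨Eventually.of_forall fun ξ => (hfi.comp_mul_right (b ξ)).const_mul (k ξ), ?_⟩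
  simp only [norm_mul, integral_const_mul, integral_mul_right_eq_self (fun x => ‖f x‖)]
  exact hki.norm.mul_const _

/-- By Fubini and translation invariance, averaging along the flow acts on the Fourier side as
multiplication by `∫ k ξ * χ (b ξ)`. -/
theorem integral_integral_mul_flow_mul_char {f : K → ℂ} (hf : StronglyMeasurable f)
    (hfi : Integrable f μ) {b : ℝ → K} (hb : Continuous b) {k : ℝ → ℂ} (hk : Continuous k)
    (hki : Integrable k) (χ : K →ₜ* Circle) :
    ∫ ω, (∫ ξ, k ξ * f (ω * b ξ)) * (starRingEnd ℂ) (χ ω : ℂ) ∂μ =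
      (∫ ξ, k ξ * (χ (b ξ) : ℂ)) * ∫ ω, f ω * (starRingEnd ℂ) (χ ω : ℂ) ∂μ := by
  have hint : Integrable (fun p : K × ℝ => k p.2 * f (p.1 * b p.2) *
      (starRingEnd ℂ) (χ p.1 : ℂ)) (μ.prod volume) := by
    refine (integrable_prod_mul_flow μ hf hfi hb hk hki).mul_bdd (c := 1) ?_ ?_
    · exact ((by fun_prop : Continuous fun ω => (starRingEnd ℂ) (χ ω : ℂ)).measurable.comp
        measurable_fst).aestronglyMeasurable
    · refine Eventually.of_forall fun p => ?_
      rw [RCLike.norm_conj, Circle.norm_coe]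
  simp only [← integral_mul_const]
  rw [integral_integral_swap hint]
  congr 1
  ext ξ
  rw [← integral_const_mul, 
    ← integral_mul_right_eq_self
      (fun ω => k ξ * (χ (b ξ) : ℂ) * (f ω * (starRingEnd ℂ) (χ ω : ℂ))) (b ξ)]
  congr 1
  ext ω
  have h1 : (χ (b ξ) : ℂ) * (starRingEnd ℂ) (χ (b ξ) : ℂ) = 1 := by
    rw [← Circle.coe_inv_eq_conj, ← Circle.coe_mul, mul_inv_cancel, Circle.coe_one]
  simp only [map_mul, Circle.coe_mul]
  linear_combination (-(k ξ * f (ω * b ξ) * (starRingEnd ℂ) (χ ω : ℂ))) * h1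

/-- Hölder's inequality on the finite measure `ν`, then Fubini and invariance. The operator norm is
bounded by the mass of `ν` for every `p`. -/
theorem lintegral_rpow_lintegral_flow_le {f : K → ℂ} (hf : StronglyMeasurable f)
    {b : ℝ → K} (hb : Continuous b) (ν : Measure ℝ) [IsFiniteMeasure ν] {p : ℝ} (hp : 1 ≤ p) :
    ∫⁻ ω, (∫⁻ ξ, ‖f (ω * b ξ)‖ₑ ∂ν) ^ p ∂μ ≤ ν Set.univ ^ p * ∫⁻ ω, ‖f ω‖ₑ ^ p ∂μ := by
  have hp0 : 0 < p := by linarith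
  have hjoint : Measurable fun q : K × ℝ => ‖f (q.1 * b q.2)‖ₑ ^ p :=
    (hf.comp_measurable (by fun_prop : Continuous fun p : K × ℝ => p.1 * b p.2).measurable).enorm.pow_const p
  have hpt : ∀ ω, (∫⁻ ξ, ‖f (ω * b ξ)‖ₑ ∂ν) ^ p ≤
      ν Set.univ ^ (p - 1) * ∫⁻ ξ, ‖f (ω * b ξ)‖ₑ ^ p ∂ν := by
    intro ω
    have hm : AEStronglyMeasurable (fun ξ => f (ω * b ξ)) ν :=
      (hf.comp_measurable (by fun_prop : Continuous fun ξ => ω * b ξ).measurable).aestronglyMeasurable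
    have h1 := eLpNorm_le_eLpNorm_mul_rpow_measure_univ (p := 1) (q := ENNReal.ofReal p)
      (by simpa using ENNReal.ofReal_le_ofReal hp) hm
    rw [eLpNorm_one_eq_lintegral_enorm, eLpNorm_eq_lintegral_rpow_enorm_toReal (by simpa using hp0)
      ENNReal.ofReal_ne_top, ENNReal.toReal_ofReal hp0.le, ENNReal.toReal_one] at h1
    have h2 := ENNReal.rpow_le_rpow h1 hp0.le
    rw [ENNReal.mul_rpow_of_nonneg _ _ hp0.le, ← ENNReal.rpow_mul, ← ENNReal.rpow_mul,
      one_div_mul_cancel hp0.ne', ENNReal.rpow_one, sub_mul, one_div_mul_cancel hp0.ne', div_one,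
      one_mul, mul_comm] at h2
    exact h2
  calc _ ≤ ∫⁻ ω, ν Set.univ ^ (p - 1) * ∫⁻ ξ, ‖f (ω * b ξ)‖ₑ ^ p ∂ν ∂μ := lintegral_mono hpt
    _ = ν Set.univ ^ (p - 1) * ∫⁻ ξ, ∫⁻ ω, ‖f (ω * b ξ)‖ₑ ^ p ∂μ ∂ν := by
        rw [lintegral_const_mul _ hjoint.lintegral_prod_right',
          lintegral_lintegral_swap hjoint.aemeasurable]
    _ = ν Set.univ ^ (p - 1) * (ν Set.univ * ∫⁻ ω, ‖f ω‖ₑ ^ p ∂μ) := by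
        simp only [lintegral_mul_right_eq_self (fun x => ‖f x‖ₑ ^ p)]
        rw [lintegral_const, mul_comm (∫⁻ _, _ ∂_)]
    _ = _ := by
        rw [← mul_assoc]
        congr 1
        rcases eq_or_ne (ν Set.univ) 0 with h0 | h0
        · simp [h0, hp0]
        · nth_rw 2 [← ENNReal.rpow_one (ν Set.univ)]
          rw [← ENNReal.rpow_add _ _ h0 (measure_ne_top _ _), sub_add_cancel]

end FlowConvolution

/-! ### Normalized Haar measure -/

section NormalizedHaar

variable (G : Type*) [CommGroup G] [TopologicalSpace G] [IsTopologicalGroup G] [CompactSpace G]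
  [MeasurableSpace G] [BorelSpace G]

instance : (normalizedHaar G).IsHaarMeasure := by unfold normalizedHaar; infer_instance

instance : (normalizedHaar G).Regular := by unfold normalizedHaar; infer_instance

instance : IsProbabilityMeasure (normalizedHaar G) := by
  refine ⟨?_⟩
  rw [normalizedHaar]
  exact Measure.haarMeasure_self (K₀ := (⊤ : TopologicalSpace.PositiveCompacts G))

end NormalizedHaar

/-! ### The flow and the characters of a Dirichlet group -/

section DirichletGroup

variable {lam : ℕ → ℝ} {K : Type*} [CommGroup K] [TopologicalSpace K] {κ : Multiplicative ℝ →* K}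

/-- The flow `t ↦ κ t` of a Dirichlet group, on the additive real line. -/
def flow (κ : Multiplicative ℝ →* K) (t : ℝ) : K := κ (Multiplicative.ofAdd t)

omit [TopologicalSpace K] in
theorem flow_add (κ : Multiplicative ℝ →* K) (s t : ℝ) : flow κ (s + t) = flow κ s * flow κ t := by
  simp [flow]

variable (hκ : IsLambdaDirichletGroup lam κ)
include hκ

theorem IsLambdaDirichletGroup.continuous_flow : Continuous (flow κ) :=
  hκ.continuous.comp continuous_ofAdd

theorem IsLambdaDirichletGroup.denseRange_flow : DenseRange (flow κ) :=
  hκ.denseRange.comp Multiplicative.ofAdd.surjective.denseRange hκ.continuous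

theorem IsLambdaDirichletGroup.h_flow (n : ℕ) (t : ℝ) :
    (hκ.h n (flow κ t) : ℂ) = Complex.exp (↑(-(lam n * t)) * Complex.I) := by
  rw [flow, hκ.h_spec, Circle.coe_exp]

theorem IsLambdaDirichletGroup.h_injective (hlam : IsFrequency lam) :
    Function.Injective hκ.h := by
  intro m n hmn
  by_contra hne
  have hd : lam m - lam n ≠ 0 := sub_ne_zero.2 (hlam.strictMono.injective.ne hne)
  -- At time `π / (λ_m - λ_n)` the two characters differ by the factor `-1`.
  have h1 := hκ.h_flow m (Real.pi / (lam m - lam n))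
  rw [hmn, hκ.h_flow n] at h1
  have h2 : Complex.exp (↑(-(lam n * (Real.pi / (lam m - lam n)))) * Complex.I) =
      Complex.exp (↑(-(lam m * (Real.pi / (lam m - lam n)))) * Complex.I) *
        Complex.exp (Real.pi * Complex.I) := by
    rw [← Complex.exp_add]
    congr 1
    rw [← add_mul]
    congr 1
    norm_cast
    field_simp
    ring
  rw [Complex.exp_pi_mul_I, ← h1] at h2
  have h3 := Complex.exp_ne_zero (↑(-(lam n * (Real.pi / (lam m - lam n)))) * Complex.I)
  exact h3 (by linear_combination h2 / 2)

end DirichletGroup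

/-! ### The maximal inequality in Hardy spaces -/

section MaximalInequality

variable {lam : ℕ → ℝ} {K : Type*} [CommGroup K] [TopologicalSpace K] [IsTopologicalGroup K]
  [CompactSpace K] [MeasurableSpace K] [BorelSpace K] {κ : Multiplicative ℝ →* K}
  {hκ : IsLambdaDirichletGroup lam κ}

/-- A strongly measurable representative makes `(ω, ξ) ↦ f (ω * b ξ)` jointly measurable. -/
theorem IsBohrTransform.exists_stronglyMeasurable {p : ℝ≥0∞} {f : K → ℂ} {a : ℕ → ℂ}
    (hf : IsBohrTransform hκ p f a) :
    ∃ g, StronglyMeasurable g ∧ f =ᵐ[normalizedHaar K] g ∧ IsBohrTransform hκ p g a := by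
  obtain ⟨g, hg, hfg⟩ := hf.mem.memLp.1
  have hc : ∀ χ, groupFourierCoeff f χ = groupFourierCoeff g χ := fun χ =>
    integral_congr_ae (by filter_upwards [hfg] with x hx; rw [hx])
  exact ⟨g, hg, hfg, ⟨(memLp_congr_ae hfg).1 hf.mem.memLp, fun χ hχ => by
    rw [← hc]; exact hf.mem.support χ hχ⟩, fun n => by rw [← hc]; exact hf.coeff n⟩

/-- Spectral cut-offs of a function in the Hardy space are convolutions along the flow. -/
theorem IsBohrTransform.ae_sum_eq_integral [T2Space K] (hlam : IsFrequency lam) {p : ℝ≥0∞}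
    (hp : 1 ≤ p) {f : K → ℂ} {a : ℕ → ℂ} (hf : IsBohrTransform hκ p f a)
    (hfm : StronglyMeasurable f) {k : ℝ → ℂ} (hk : Continuous k) (hki : Integrable k) {N : ℕ}
    (hkN : ∀ m, ∫ ξ, k ξ * Complex.exp (↑(2 * Real.pi * ξ * lam m) * Complex.I) =
      if m ≤ N then 1 else 0) :
    ∀ᵐ ω ∂normalizedHaar K, ∑ n ∈ Finset.range (N + 1), a n * (hκ.h n ω : ℂ) =
      ∫ ξ, k ξ * f (ω * flow κ (-2 * Real.pi * ξ)) := by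
  set μ := normalizedHaar K
  have hfi : Integrable f μ := hf.mem.memLp.integrable hp
  have hb : Continuous fun ξ : ℝ => flow κ (-2 * Real.pi * ξ) :=
    hκ.continuous_flow.comp (by fun_prop)
  have hPi : Integrable (fun ω => ∫ ξ, k ξ * f (ω * flow κ (-2 * Real.pi * ξ))) μ :=
    (integrable_prod_mul_flow μ hfm hfi hb hk hki).integral_prod_left
  have hSi : Integrable (fun ω => ∑ n ∈ Finset.range (N + 1), a n * (hκ.h n ω : ℂ)) μ :=
    Continuous.integrable_of_compactSpace μ (by fun_prop)
  have hbd : ∀ {F : K → ℂ} (χ : K →ₜ* Circle), Integrable F μ →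
      Integrable (fun ω => F ω * (starRingEnd ℂ) (χ ω : ℂ)) μ := fun χ hF =>
    hF.mul_bdd (c := 1)
      (by fun_prop : Continuous fun ω => (starRingEnd ℂ) (χ ω : ℂ)).measurable.aestronglyMeasurable
      (Eventually.of_forall fun ω => by rw [RCLike.norm_conj, Circle.norm_coe])
  have hzero := ae_eq_zero_of_forall_char_integral_eq_zero μ (hSi.sub hPi) fun χ => by
    simp only [Pi.sub_apply, sub_mul]
    rw [integral_sub (hbd χ hSi) (hbd χ hPi),
      integral_integral_mul_flow_mul_char μ hfm hfi hb hk hki χ]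
    have hS : ∫ ω, (∑ n ∈ Finset.range (N + 1), a n * (hκ.h n ω : ℂ)) *
        (starRingEnd ℂ) (χ ω : ℂ) ∂μ = ∑ n ∈ Finset.range (N + 1),
          a n * ∫ ω, (hκ.h n ω : ℂ) * (starRingEnd ℂ) (χ ω : ℂ) ∂μ := by
      simp only [Finset.sum_mul, mul_assoc]
      rw [integral_finsetSum _ fun n _ =>
        Continuous.integrable_of_compactSpace μ (by fun_prop)]
      simp only [integral_const_mul]
    rw [hS]
    by_cases hχ : ∃ m, χ = hκ.h m
    · obtain ⟨m, rfl⟩ := hχ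
      have h1 : ∫ ω, f ω * (starRingEnd ℂ) (hκ.h m ω : ℂ) ∂μ = a m := (hf.coeff m).symm
      -- The time `-2πξ` turns `e^{-iλt}` into the exponential of Fourier inversion.
      have h2 : ∀ ξ : ℝ, (hκ.h m (flow κ (-2 * Real.pi * ξ)) : ℂ) =
          Complex.exp (↑(2 * Real.pi * ξ * lam m) * Complex.I) := fun ξ => by
        rw [hκ.h_flow]
        congr 3
        ring
      have h3 : ∀ n, a n * ∫ ω, (hκ.h n ω : ℂ) * (starRingEnd ℂ) (hκ.h m ω : ℂ) ∂μ =
          if n = m then a m else 0 := by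
        intro n
        split_ifs with hnm
        · rw [hnm, integral_char_mul_conj_char_self, mul_one]
        · rw [integral_char_mul_conj_char_of_ne μ ((hκ.h_injective hlam).ne hnm), mul_zero]
      simp only [h2, h3, hkN, h1, Finset.sum_ite_eq', Finset.mem_range, Nat.lt_succ_iff]
      split_ifs <;> simp
    · push Not at hχ
      have h1 : ∫ ω, f ω * (starRingEnd ℂ) (χ ω : ℂ) ∂μ = 0 := hf.mem.support χ hχ
      rw [h1, mul_zero, sub_zero]
      refine Finset.sum_eq_zero fun n _ => ?_
      rw [integral_char_mul_conj_char_of_ne μ (hχ n).symm, mul_zero]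
  filter_upwards [hzero] with ω hω
  exact sub_eq_zero.1 hω

omit [IsTopologicalGroup K] [CompactSpace K] [MeasurableSpace K] [BorelSpace K] in
theorem verticalMaximal_zero_le (hlam : IsFrequency lam) {a : ℕ → ℂ} {v : ℝ} (hv : 0 < v) {ω : K}
    {Q : ℝ≥0∞} (h : ∀ N, ENNReal.ofReal (Real.exp (-(v * lam N))) *
      ‖∑ n ∈ Finset.range (N + 1), a n * (hκ.h n ω : ℂ)‖ₑ ≤ Q) :
    verticalMaximal hκ a (2 * v) ω 0 ≤ 2 * Q := by
  rcases eq_or_ne Q ∞ with rfl | hQ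
  · simp
  refine iSup_le fun N => ?_
  have h1 := norm_sum_mul_exp_le (c := fun n => a n * (hκ.h n ω : ℂ)) hlam.strictMono.monotone
    hlam.nonneg hv (Q := Q.toReal) ENNReal.toReal_nonneg (fun N => by
      have := (ENNReal.ofReal_le_iff_le_toReal hQ).1 (show ENNReal.ofReal (Real.exp (-(v * lam N)) *
        ‖∑ n ∈ Finset.range (N + 1), a n * (hκ.h n ω : ℂ)‖) ≤ Q by
          rw [ENNReal.ofReal_mul (Real.exp_nonneg _), ofReal_norm]; exact h N)
      exact this) N
  have h2 : ∀ n, a n * (hκ.h n ω : ℂ) *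
      Complex.exp (-(((2 * v : ℝ) : ℂ) + Complex.I * ((0 : ℝ) : ℂ)) * (lam n : ℂ)) =
      a n * (hκ.h n ω : ℂ) * (Real.exp (-(v * lam n)) ^ 2 : ℝ) := by
    intro n
    rw [← Real.exp_nat_mul]
    push_cast
    congr 2
    ring
  simp only [h2]
  rw [← ofReal_norm]
  calc _ ≤ ENNReal.ofReal (2 * Q.toReal) := ENNReal.ofReal_le_ofReal h1
    _ = 2 * Q := by
      rw [ENNReal.ofReal_mul (by norm_num), ENNReal.ofReal_toReal hQ]; simp

/-- The maximal inequality for functions in Hardy spaces under Bohr's condition. -/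
theorem BohrCondition.exists_lintegral_verticalMaximal_le (hlam : IsFrequency lam)
    (hBC : BohrCondition lam) {u : ℝ} (hu : 0 < u) :
    ∃ C : ℝ, 0 < C ∧ ∀ p : ℝ, 1 ≤ p →
      ∀ (K : Type*) [CommGroup K] [TopologicalSpace K] [IsTopologicalGroup K] [CompactSpace K]
        [T2Space K] [MeasurableSpace K] [BorelSpace K] (κ : Multiplicative ℝ →* K)
        (hκ : IsLambdaDirichletGroup lam κ) (f : K → ℂ) (a : ℕ → ℂ),
        IsBohrTransform hκ (ENNReal.ofReal p) f a →
        ∫⁻ ω, verticalMaximal hκ a u ω 0 ^ p ∂normalizedHaar K ≤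
          (ENNReal.ofReal C * eLpNorm f (ENNReal.ofReal p) (normalizedHaar K)) ^ p := by
  -- Half of `u` goes to the kernels, the other half to Abel summation.
  obtain ⟨k, g, hgc, hgi, hg0, hkc, hki, hkg, hkN⟩ := hBC.exists_kernel hlam (half_pos hu)
  set ν : Measure ℝ := volume.withDensity fun ξ => ENNReal.ofReal (g ξ) with hν
  have : IsFiniteMeasure ν := isFiniteMeasure_withDensity_ofReal hgi.2
  -- The factor `2` comes from Abel summation and the mass of `ν` is `∫ g`; the `1` only ensures
  -- positivity.
  refine ⟨2 * (ν Set.univ).toReal + 1, by positivity, ?_⟩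
  intro p hp K _ _ _ _ _ _ _ κ hκ f₀ a hf₀
  obtain ⟨f, hfm, hff, hf⟩ := hf₀.exists_stronglyMeasurable
  rw [eLpNorm_congr_ae hff]
  clear hf₀ hff f₀
  set μ := normalizedHaar K
  have hp0 : 0 < p := by linarith
  have hp' : 1 ≤ ENNReal.ofReal p := by simpa using ENNReal.ofReal_le_ofReal hp
  have hb : Continuous fun ξ : ℝ => flow κ (-2 * Real.pi * ξ) :=
    hκ.continuous_flow.comp (by fun_prop)
  have hae : ∀ᵐ ω ∂μ, ∀ N, ∑ n ∈ Finset.range (N + 1), a n * (hκ.h n ω : ℂ) =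
      ∫ ξ, k N ξ * f (ω * flow κ (-2 * Real.pi * ξ)) :=
    ae_all_iff.2 fun N => hf.ae_sum_eq_integral hlam hp' hfm (hkc N) (hki N) (hkN N)
  have hmax : ∀ᵐ ω ∂μ, verticalMaximal hκ a u ω 0 ≤
      2 * ∫⁻ ξ, ‖f (ω * flow κ (-2 * Real.pi * ξ))‖ₑ ∂ν := by
    filter_upwards [hae] with ω hω
    have h1 : u = 2 * (u / 2) := by ring
    nth_rw 1 [h1]
    refine verticalMaximal_zero_le hlam (half_pos hu) fun N => ?_
    have hm : Measurable fun ξ => ‖f (ω * flow κ (-2 * Real.pi * ξ))‖ₑ :=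
      (hfm.comp_measurable (by fun_prop :
        Continuous fun ξ : ℝ => ω * flow κ (-2 * Real.pi * ξ)).measurable).enorm
    rw [hω N, hν, lintegral_withDensity_eq_lintegral_mul _ hgc.measurable.ennreal_ofReal hm]
    calc _ ≤ ENNReal.ofReal (Real.exp (-(u / 2 * lam N))) *
          ∫⁻ ξ, ‖k N ξ * f (ω * flow κ (-2 * Real.pi * ξ))‖ₑ := by
          gcongr; exact enorm_integral_le_lintegral_enorm _
      _ = ∫⁻ ξ, ENNReal.ofReal (Real.exp (-(u / 2 * lam N))) *
          ‖k N ξ * f (ω * flow κ (-2 * Real.pi * ξ))‖ₑ := by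
          rw [lintegral_const_mul' _ _ ENNReal.ofReal_ne_top]
      _ ≤ _ := by
          refine lintegral_mono fun ξ => ?_
          simp only [Pi.mul_apply]
          rw [enorm_mul, ← mul_assoc]
          gcongr
          rw [← ofReal_norm, ← ENNReal.ofReal_mul (Real.exp_nonneg _)]
          exact ENNReal.ofReal_le_ofReal (hkg N ξ)
  calc ∫⁻ ω, verticalMaximal hκ a u ω 0 ^ p ∂μ
      ≤ ∫⁻ ω, 2 ^ p * (∫⁻ ξ, ‖f (ω * flow κ (-2 * Real.pi * ξ))‖ₑ ∂ν) ^ p ∂μ := by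
        refine lintegral_mono_ae ?_
        filter_upwards [hmax] with ω hω
        rw [← ENNReal.mul_rpow_of_nonneg _ _ hp0.le]
        gcongr
    _ ≤ 2 ^ p * (ν Set.univ ^ p * ∫⁻ ω, ‖f ω‖ₑ ^ p ∂μ) := by
        rw [lintegral_const_mul' _ _ (by simp)]
        gcongr
        exact lintegral_rpow_lintegral_flow_le μ hfm hb ν hp
    _ = (2 * ν Set.univ * eLpNorm f (ENNReal.ofReal p) μ) ^ p := by
        rw [eLpNorm_eq_lintegral_rpow_enorm_toReal (by simpa using hp0) ENNReal.ofReal_ne_top,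
          ENNReal.toReal_ofReal hp0.le, ENNReal.mul_rpow_of_nonneg _ _ hp0.le,
          ENNReal.mul_rpow_of_nonneg _ _ hp0.le, ← ENNReal.rpow_mul, one_div_mul_cancel hp0.ne',
          ENNReal.rpow_one, mul_assoc]
    _ ≤ _ := by
        gcongr
        rw [ENNReal.ofReal_add (by positivity) zero_le_one, ENNReal.ofReal_mul (by norm_num),
          ENNReal.ofReal_toReal (measure_ne_top _ _)]
        simp

end MaximalInequality

/-! ### Transfer between Dirichlet groups -/

section Transfer

variable {lam : ℕ → ℝ} {G : Type*} [CommGroup G] [TopologicalSpace G] {β : Multiplicative ℝ →* G}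

/-- `max_{N ≤ M} |∑_{n ≤ N} aₙ h_{λₙ}(ω) e^{-uλₙ}|`. -/
noncomputable def partialMaximal (hβ : IsLambdaDirichletGroup lam β) (a : ℕ → ℂ) (u : ℝ) (M : ℕ)
    (ω : G) : NNReal :=
  (Finset.range (M + 1)).sup fun N => ‖∑ n ∈ Finset.range (N + 1),
    a n * (hβ.h n ω : ℂ) * Complex.exp (-(u : ℂ) * (lam n : ℂ))‖₊

variable (hβ : IsLambdaDirichletGroup lam β) (a : ℕ → ℂ) (u : ℝ)

theorem continuous_partialMaximal (M : ℕ) : Continuous (partialMaximal hβ a u M) := by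
  refine Continuous.finset_sup_apply fun N _ => ?_
  fun_prop

theorem monotone_partialMaximal : Monotone (partialMaximal hβ a u) := fun M N h ω =>
  Finset.sup_mono (Finset.range_subset_range.2 (by omega))

/-- The factor `e^{-itλₙ}` is `h_{λₙ}` at `flow β t`, so moving up the vertical line is translation
along the flow. -/
theorem verticalMaximal_eq_iSup_partialMaximal (ω : G) (t : ℝ) :
    verticalMaximal hβ a u ω t = ⨆ M, (partialMaximal hβ a u M (ω * flow β t) : ℝ≥0∞) := by
  have h1 : ∀ N, ‖∑ n ∈ Finset.range (N + 1), a n * (hβ.h n ω : ℂ) *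
        Complex.exp (-((u : ℂ) + Complex.I * (t : ℂ)) * (lam n : ℂ))‖ₑ =
      ((‖∑ n ∈ Finset.range (N + 1), a n * (hβ.h n (ω * flow β t) : ℂ) *
        Complex.exp (-(u : ℂ) * (lam n : ℂ))‖₊ : NNReal) : ℝ≥0∞) := by
    intro N
    rw [← enorm_eq_nnnorm]
    congr 2
    ext n
    rw [map_mul, Circle.coe_mul, hβ.h_flow, mul_assoc, mul_assoc, mul_assoc, ← Complex.exp_add]
    congr 3
    push_cast
    ring
  simp only [verticalMaximal, h1]
  refine le_antisymm (iSup_le fun N => ?_) (iSup_le fun M => ?_)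
  · refine le_iSup_of_le N (ENNReal.coe_le_coe.2 ?_)
    exact Finset.le_sup (f := fun N => ‖∑ n ∈ Finset.range (N + 1),
      a n * (hβ.h n (ω * flow β t) : ℂ) * Complex.exp (-(u : ℂ) * (lam n : ℂ))‖₊)
      (Finset.mem_range.2 N.lt_succ_self)
  · rw [partialMaximal, ENNReal.coe_finset_sup]
    exact Finset.sup_le fun N _ => le_iSup (fun N => ((‖∑ n ∈ Finset.range (N + 1),
      a n * (hβ.h n (ω * flow β t) : ℂ) * Complex.exp (-(u : ℂ) * (lam n : ℂ))‖₊ : NNReal) : ℝ≥0∞)) N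

theorem verticalMaximal_rpow_eq_iSup {p : ℝ} (hp : 0 < p) (ω : G) (t : ℝ) :
    verticalMaximal hβ a u ω t ^ p =
      ⨆ M, ((partialMaximal hβ a u M (ω * flow β t) ^ p : NNReal) : ℝ≥0∞) := by
  rw [verticalMaximal_eq_iSup_partialMaximal]
  simp only [ENNReal.coe_rpow_of_nonneg _ hp.le]
  exact (ENNReal.orderIsoRpow p hp).map_iSup _

/-- On the orbit through `1` the characters are the exponentials `e^{-iλₙt}`, whatever the group. -/
theorem partialMaximal_flow_eq {K : Type*} [CommGroup K] [TopologicalSpace K]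
    {κ : Multiplicative ℝ →* K} (hκ : IsLambdaDirichletGroup lam κ) (M : ℕ) (t : ℝ) :
    partialMaximal hβ a u M (flow β t) = partialMaximal hκ a u M (flow κ t) := by
  simp only [partialMaximal, hβ.h_flow, hκ.h_flow]

theorem continuous_partialMaximal_rpow {p : ℝ} (hp : 0 < p) (M : ℕ) :
    Continuous fun x => partialMaximal hβ a u M x ^ p :=
  (NNReal.continuous_rpow_const hp.le).comp (continuous_partialMaximal hβ a u M)

theorem monotone_partialMaximal_rpow {p : ℝ} (hp : 0 < p) :
    Monotone fun M x => partialMaximal hβ a u M x ^ p := fun _ _ h x =>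
  NNReal.rpow_le_rpow (monotone_partialMaximal hβ a u h x) hp.le

variable [IsTopologicalGroup G] [CompactSpace G] [MeasurableSpace G] [BorelSpace G]

/-- The maximal functions of a Dirichlet series on two Dirichlet groups have the same
`p`-th moments. -/
theorem lintegral_verticalMaximal_rpow_eq {K : Type*} [CommGroup K] [TopologicalSpace K]
    [IsTopologicalGroup K] [CompactSpace K] [MeasurableSpace K] [BorelSpace K]
    {κ : Multiplicative ℝ →* K} (hκ : IsLambdaDirichletGroup lam κ) {p : ℝ} (hp : 0 < p) :
    ∫⁻ ω, ⨆ M, ((partialMaximal hβ a u M ω ^ p : NNReal) : ℝ≥0∞) ∂normalizedHaar G =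
      ∫⁻ ω, ⨆ M, ((partialMaximal hκ a u M ω ^ p : NNReal) : ℝ≥0∞) ∂normalizedHaar K := by
  rw [lintegral_iSup
      (fun M => (continuous_partialMaximal_rpow hβ a u hp M).measurable.coe_nnreal_ennreal)
      (fun M N h x => ENNReal.coe_le_coe.2 (monotone_partialMaximal_rpow hβ a u hp h x)),
    lintegral_iSup
      (fun M => (continuous_partialMaximal_rpow hκ a u hp M).measurable.coe_nnreal_ennreal)
      (fun M N h x => ENNReal.coe_le_coe.2 (monotone_partialMaximal_rpow hκ a u hp h x))]
  congr 1
  ext M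
  -- Unique ergodicity holds at every point, so the base point may be `1`, where both groups give
  -- the same orbit means.
  have h1 := tendsto_flowLMean_coe (normalizedHaar G) (continuous_partialMaximal_rpow hβ a u hp M)
    hβ.continuous_flow (flow_add β) hβ.denseRange_flow 1
  have h2 := tendsto_flowLMean_coe (normalizedHaar K) (continuous_partialMaximal_rpow hκ a u hp M)
    hκ.continuous_flow (flow_add κ) hκ.denseRange_flow 1
  simp only [flowLMean, one_mul] at h1 h2
  simp only [partialMaximal_flow_eq hβ a u hκ] at h1
  exact tendsto_nhds_unique h1 h2

end Transfer

/-! ### Conclusion -/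

theorem mainTheorem6 (lam : ℕ → ℝ) (hlam : IsFrequency lam) (hBC : BohrCondition lam)
    (u : ℝ) (hu : 0 < u) :
    ∃ C : ℝ, 0 < C ∧ ∀ p : ℝ, 1 ≤ p →
      -- a Dirichlet series in the Hardy space, with coefficients `a` and norm `‖f‖_p`
      ∀ (K : Type*) [CommGroup K] [TopologicalSpace K] [IsTopologicalGroup K] [CompactSpace K]
        [T2Space K] [MeasurableSpace K] [BorelSpace K] (κ : Multiplicative ℝ →* K)
        (hκ : IsLambdaDirichletGroup lam κ) (f : K → ℂ) (a : ℕ → ℂ),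
        IsBohrTransform hκ (ENNReal.ofReal p) f a →
      -- an arbitrary, possibly different, Dirichlet group on which the vertical limits are taken
      ∀ (G : Type*) [CommGroup G] [TopologicalSpace G] [IsTopologicalGroup G] [CompactSpace G]
        [T2Space G] [MeasurableSpace G] [BorelSpace G] (β : Multiplicative ℝ →* G)
        (hβ : IsLambdaDirichletGroup lam β),
      ∀ᵐ ω ∂(normalizedHaar G), ∃ L : ℝ≥0∞,
        Tendsto (fun T : ℝ => verticalMaximalMean hβ a u p ω T) atTop (𝓝 L) ∧
          L ≤ ENNReal.ofReal C * eLpNorm f (ENNReal.ofReal p) (normalizedHaar K) := by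
  obtain ⟨C, hC, hmax⟩ := hBC.exists_lintegral_verticalMaximal_le hlam hu
  refine ⟨C, hC, ?_⟩
  intro p hp K _ _ _ _ _ _ _ κ hκ f a hf G _ _ _ _ _ _ _ β hβ
  have hp0 : 0 < p := by linarith
  have hκ0 : ∀ ω, verticalMaximal hκ a u ω 0 ^ p =
      ⨆ M, ((partialMaximal hκ a u M ω ^ p : NNReal) : ℝ≥0∞) := fun ω => by
    have h0 : flow κ 0 = 1 := by simp [flow]
    rw [verticalMaximal_rpow_eq_iSup hκ a u hp0, h0, mul_one]
  have hK := hmax p hp K κ hκ f a hf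
  simp only [hκ0] at hK
  -- The maximal inequality was proved on `K`, where `f` lives; the moment is now read on `G`, and
  -- its finiteness is what the ergodic theorem requires.
  rw [← lintegral_verticalMaximal_rpow_eq hβ a u hκ hp0] at hK
  have hfin : ∫⁻ ω, ⨆ M, ((partialMaximal hβ a u M ω ^ p : NNReal) : ℝ≥0∞) ∂normalizedHaar G ≠ ∞ :=
    ne_top_of_le_ne_top (ENNReal.rpow_ne_top_of_nonneg hp0.le
      (ENNReal.mul_ne_top ENNReal.ofReal_ne_top hf.mem.memLp.2.ne)) hK
  filter_upwards [ae_tendsto_flowLMean_iSup (normalizedHaar G)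
    (continuous_partialMaximal_rpow hβ a u hp0) (monotone_partialMaximal_rpow hβ a u hp0) hfin
    hβ.continuous_flow (flow_add β) hβ.denseRange_flow] with ω hω
  refine ⟨_, ((ENNReal.continuous_rpow_const (y := 1 / p)).tendsto _).comp hω |>.congr fun T => ?_, ?_⟩
  · simp only [Function.comp_apply, verticalMaximalMean, flowLMean,
      verticalMaximal_rpow_eq_iSup hβ a u hp0]
  · calc _ ≤ ((ENNReal.ofReal C * eLpNorm f (ENNReal.ofReal p) (normalizedHaar K)) ^ p) ^ (1 / p) := by
          gcongr
      _ = _ := by rw [← ENNReal.rpow_mul, mul_one_div_cancel hp0.ne', ENNReal.rpow_one]
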